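/- **Setting.** Call $U\subset\mathbb R^2$ a *smooth closed domain* if it is compact and near each $p\in\partial U$ it coincides with $\{r\le 0\}$ for some $C^\infty$ function $r$ with $\nabla r(p)\neq 0$ (connectedness is not required). Let $n$ be its exterior unit normal, $\gamma$ the arc length on $\partial U$, and, for $C^1$ functions on $U$, let $\nabla$ denote the gradient up to the boundary. Let $\mathbb T$ be the open triangle with vertices $(0,0),(1,0),(0,1)$, and for $\rho\in\mathbb T$ put $$\sigma(\rho)=\tfrac1\pi\big[\Lambda(\pi\rho_1)+\Lambda(\pi\rho_2)+\Lambda(\pi(1-\rho_1-\rho_2))\big],\quad \Lambda(\theta)=\int_0^\theta\ln(2\sin t)\,dt,$$ $$V(\rho)=\frac1\pi\frac{\sin(\pi\rho_1)\sin(\pi\rho_2)}{\sin(\pi(1-\rho_1-\rho_2))},\qquad \mu(\rho)=\tfrac12V(\rho),$$ $$W^{(1)}(\rho_1,\rho_2)=-\tfrac1{2\pi}\cot(\pi(\rho_1+\rho_2))\sin^2(\pi\rho_2)-\tfrac{\rho_2}4+\tfrac1{4\pi}\sin(2\pi\rho_2),\quad W^{(2)}(\rho_1,\rho_2)=W^{(1)}(\rho_2,\rho_1),$$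 and $W=(W^{(1)},W^{(2)})$. For $s\in(-1,1)\times(0,\infty)$ put $\rho(s)=\big(\frac{1-s_1}{2+s_2},\frac{1+s_1}{2+s_2}\big)$, $\hat\sigma(s)=(1+\frac{s_2}2)\sigma(\rho(s))$, $\hat\mu=\frac1{2\hat\sigma_{1,1}}$ and $$G(s)=(1+\tfrac{s_2}2)\big[\rho_1(s)\rho_2(s)-(\rho_1(s)+\rho_2(s))V(\rho(s))\big].$$ Subscripts $i,j$ on $\sigma,\hat\sigma$ denote second partial derivatives. A *classical solution* on $U\times[0,\infty)$ of an equation $\partial_t\psi=\sum_{i,j}a_{ij}(\nabla\psi)\,\partial_{u_i}\partial_{u_j}\psi$ with datum $\psi_0$ and slopes in an open set $S\subset\mathbb R^2$ is a function $\psi$ that is $C^1$ on $U\times[0,\infty)$, is $C^2$ in space in the interior of $U$ at each time $t>0$, satisfies $\nabla\psi\in S$ on $U\times[0,\infty)$, satisfies the equation in the interior for $t>0$, and equals $\psi_0(u)$ if $t=0$ or $u\in\partial U$. **Theorem.** Let $U$ and $V$ be smooth closed domains (this $V\subset\mathbb R^2$ is not to be confused with the function $V(\rho)$). 1. Let $\psi^{(1)},\psi^{(2)}$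 be $C^1$ on $U$ with gradients in $\mathbb T$ on $U$, $\psi^{(1)}\ge\psi^{(2)}$ on $U$ and $\psi^{(1)}=\psi^{(2)}$ on $\partial U$. Then the integrand below is $\gamma$-integrable and $$\int_{\partial U}[W(\nabla\psi^{(1)})-W(\nabla\psi^{(2)})]\cdot n\,d\gamma\le 0 .$$ 2. Let $\psi^{(1)},\psi^{(2)}$ be classical solutions on $U\times[0,\infty)$, with slopes in $\mathbb T$, of $\partial_t\psi=\mu(\nabla\psi)\sum_{i,j}\sigma_{i,j}(\nabla\psi)\,\partial_{u_i}\partial_{u_j}\psi$, with data $\psi_0^{(1)}\ge\psi_0^{(2)}$ on $U$ and $\psi_0^{(1)}=\psi_0^{(2)}$ on $\partial U$. Then $\psi^{(1)}(\cdot,t)\ge\psi^{(2)}(\cdot,t)$ on $U$ for all $t\ge0$; for every $t\ge 0$ (one-sided derivative at $t=0$) the boundary integrand below is integrable and $$\frac d{dt}\Big(\int_U\psi^{(1)}(u,t)\,du-\int_U\psi^{(2)}(u,t)\,du\Big)=\int_{\partial U}[W(\nabla\psi^{(1)}(u,t))-W(\nabla\psi^{(2)}(u,t))]\cdot n\,d\gamma\le0;$$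 and the mutual volume $\int_U|\psi^{(1)}(u,t)-\psi^{(2)}(u,t)|\,du$ is non-increasing on $[0,\infty)$. 3. Let $\hat\psi^{(1)},\hat\psi^{(2)}$ be classical solutions on $V\times[0,\infty)$, with slopes in $(-1,1)\times(0,\infty)$, of $\partial_t\hat\psi=\hat\mu(\nabla\hat\psi)\sum_{i,j}\hat\sigma_{i,j}(\nabla\hat\psi)\,\partial_{v_i}\partial_{v_j}\hat\psi$, with data $\hat\psi_0^{(1)}\ge\hat\psi_0^{(2)}$ on $V$ and $\hat\psi_0^{(1)}=\hat\psi_0^{(2)}$ on $\partial V$. Then $\hat\psi^{(1)}(\cdot,t)\ge\hat\psi^{(2)}(\cdot,t)$ on $V$ for all $t\ge0$; for every $t\ge0$ (one-sided derivative at $t=0$) the boundary integrand below is integrable and $$\frac d{dt}\int_V(\hat\psi^{(1)}-\hat\psi^{(2)})\,dv=\int_{\partial V}\Big(\tfrac12\partial_{v_1}(\hat\psi^{(1)}-\hat\psi^{(2)}),\;G(\nabla\hat\psi^{(1)})-G(\nabla\hat\psi^{(2)})\Big)\cdot n\,d\gamma\le0;$$ and $\int_V|\hat\psi^{(1)}(v,t)-\hat\psi^{(2)}(v,t)|\,dv$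 is non-increasing on $[0,\infty)$. -/

import Mathlib

open Set Filter Topology MeasureTheory
open scoped ContDiff

noncomputable section

namespace LozengeHydro

/-- The coordinate plane `ℝ²` with its Euclidean structure; coordinates `x₁, x₂` are `x 0, x 1`. -/
abbrev Plane : Type := EuclideanSpace ℝ (Fin 2)

/-! ### Calculus on planar domains -/

/-- `∂f/∂x_{i}` at `x`. -/
def partialDeriv (i : Fin 2) (f : Plane → ℝ) (x : Plane) : ℝ :=
  fderiv ℝ f x (EuclideanSpace.single i 1)

/-- `∂²f/∂x_i∂x_j` at `x`. -/
def secondPartial (i j : Fin 2) (f : Plane → ℝ) (x : Plane) : ℝ :=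
  partialDeriv i (partialDeriv j f) x

/-- The closed set `U` has smooth boundary: near each boundary point it is a sublevel set
`{r ≤ 0}` of a smooth function whose gradient does not vanish at that point. -/
def HasSmoothBoundary (U : Set Plane) : Prop :=
  ∀ p ∈ frontier U, ∃ r : Plane → ℝ, ContDiff ℝ ∞ r ∧ gradient r p ≠ 0 ∧
    ∀ᶠ x in 𝓝 p, (x ∈ U ↔ r x ≤ 0)

/-- A bounded closed domain with smooth boundary. -/
structure IsSmoothClosedDomain (U : Set Plane) : Prop where
  isCompact : IsCompact U
  smooth : HasSmoothBoundary U

/-- `ν` is the exterior unit normal of `U` at `p`: directions making an obtuse angle with `ν` point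
into `U`, and those making an acute angle with `ν` point out of `U`. -/
def IsExteriorNormal (U : Set Plane) (p ν : Plane) : Prop :=
  ‖ν‖ = 1 ∧
    (∀ d : Plane, inner ℝ d ν < 0 → ∀ᶠ t : ℝ in 𝓝[>] 0, p + t • d ∈ U) ∧
    (∀ d : Plane, 0 < inner ℝ d ν → ∀ᶠ t : ℝ in 𝓝[>] 0, p + t • d ∉ U)

/-- The exterior unit normal `n`; it exists and is unique at boundary points of a set with smooth
boundary. -/
def exteriorNormal (U : Set Plane) (p : Plane) : Plane :=
  Classical.epsilon (IsExteriorNormal U p)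

/-- The normal component `F · n`. -/
def normalComponent (U : Set Plane) (F : Plane → Plane) (p : Plane) : ℝ :=
  inner ℝ (F p) (exteriorNormal U p)

/-- The boundary flux `∫_{∂U} F · n dγ`, with `dγ` the arc length, i.e. the one-dimensional Hausdorff
measure on `∂U`. -/
def boundaryFlux (U : Set Plane) (F : Plane → Plane) : ℝ :=
  ∫ p in frontier U, normalComponent U F p ∂(Measure.hausdorffMeasure 1)

/-- The total volume `∫_U ψ(u) du` below the graph of `ψ`. -/
def volumeBelow (U : Set Plane) (ψ : Plane → ℝ) : ℝ :=
  ∫ u in U, ψ u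

/-- The spatial gradient of `ψ(·, t)` on the closed domain `U`, up to the boundary. -/
def spaceGrad (U : Set Plane) (ψ : Plane → ℝ → ℝ) (t : ℝ) (u : Plane) : Plane :=
  gradientWithin (fun v => ψ v t) U u

/-- `ψ` is a classical solution on `U × [0, ∞)` of
`∂_t ψ = ∑_{i,j} a_{ij}(∇ψ) ∂²ψ/∂u_i∂u_j`, with `ψ(u,t) = ψ₀(u)` if `t = 0` or `u ∈ ∂U`, whose
slope takes values in the set `S` of admissible slopes: `C¹` on the closed set `U × [0, ∞)` and,
at positive times, `C²` in space in the interior. -/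
structure IsClassicalSolution (S : Set Plane) (a : Plane → Fin 2 → Fin 2 → ℝ) (U : Set Plane)
    (ψ₀ : Plane → ℝ) (ψ : Plane → ℝ → ℝ) : Prop where
  contDiffOn_one : ContDiffOn ℝ 1 (fun p : Plane × ℝ => ψ p.1 p.2) (U ×ˢ Ici (0 : ℝ))
  contDiffOn_two : ∀ t : ℝ, 0 < t → ContDiffOn ℝ 2 (fun u => ψ u t) (interior U)
  slope_mem : ∀ t : ℝ, 0 ≤ t → ∀ u ∈ U, spaceGrad U ψ t u ∈ S
  equation : ∀ t : ℝ, 0 < t → ∀ u ∈ interior U,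
    HasDerivAt (fun s => ψ u s)
      (∑ i, ∑ j, a (spaceGrad U ψ t u) i j * secondPartial i j (fun v => ψ v t) u) t
  initial : ∀ u ∈ U, ψ u 0 = ψ₀ u
  boundary : ∀ t : ℝ, 0 ≤ t → ∀ u ∈ frontier U, ψ u t = ψ₀ u

/-! ### The height function and its hydrodynamic equation -/

/-- The open triangle with vertices `(0,0), (1,0), (0,1)`. -/
def triangle : Set Plane := {ρ | 0 < ρ 0 ∧ 0 < ρ 1 ∧ ρ 0 + ρ 1 < 1}

/-- `Λ(θ) = ∫_0^θ ln (2 sin t) dt`. -/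
def lobLambda (θ : ℝ) : ℝ := ∫ t in (0 : ℝ)..θ, Real.log (2 * Real.sin t)

/-- The surface tension `σ`; only its values in the open triangle are used. -/
def surfaceTension (ρ : Plane) : ℝ :=
  (1 / Real.pi) * (lobLambda (Real.pi * ρ 0) + lobLambda (Real.pi * ρ 1)
    + lobLambda (Real.pi * (1 - ρ 0 - ρ 1)))

/-- `V(ρ)`; twice the mobility. -/
def interfaceSpeed (ρ : Plane) : ℝ :=
  (1 / Real.pi) * (Real.sin (Real.pi * ρ 0) * Real.sin (Real.pi * ρ 1)
    / Real.sin (Real.pi * (1 - ρ 0 - ρ 1)))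

/-- The mobility `μ(ρ) = V(ρ)/2`. -/
def mobility (ρ : Plane) : ℝ := interfaceSpeed ρ / 2

/-- `∂_t ψ = μ(∇ψ) ∑_{i,j} σ_{ij}(∇ψ) ∂²ψ/∂u_i∂u_j` on `U`, with initial and boundary datum `ψ₀`. -/
def IsHeightSolution (U : Set Plane) (ψ₀ : Plane → ℝ) (ψ : Plane → ℝ → ℝ) : Prop :=
  IsClassicalSolution triangle
    (fun ρ i j => mobility ρ * secondPartial i j surfaceTension ρ) U ψ₀ ψ

/-- The first component of `W`. -/
def fluxW₁ (x y : ℝ) : ℝ :=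
  -(1 / (2 * Real.pi)) * Real.cot (Real.pi * (x + y)) * Real.sin (Real.pi * y) ^ 2
    - y / 4 + 1 / (4 * Real.pi) * Real.sin (2 * Real.pi * y)

/-- The vector field `W = (W⁽¹⁾, W⁽²⁾)`, with `W⁽²⁾(ρ₁,ρ₂) = W⁽¹⁾(ρ₂,ρ₁)`. -/
def fluxW (ρ : Plane) : Plane := !₂[fluxW₁ (ρ 0) (ρ 1), fluxW₁ (ρ 1) (ρ 0)]

/-! ### The level set function and its hydrodynamic equation -/

/-- The admissible slopes `(-1,1) × (0,∞)` of the level set function. -/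
def levelSlopes : Set Plane := {s | -1 < s 0 ∧ s 0 < 1 ∧ 0 < s 1}

/-- `ρ(s) = ((1 - s₁)/(2 + s₂), (1 + s₁)/(2 + s₂))`. -/
def slopeOfLevel (s : Plane) : Plane :=
  !₂[(1 - s 0) / (2 + s 1), (1 + s 0) / (2 + s 1)]

/-- `σ̂(s) = (1 + s₂/2) σ(ρ(s))`. -/
def levelTension (s : Plane) : ℝ := (1 + s 1 / 2) * surfaceTension (slopeOfLevel s)

/-- `μ̂(s) = 1 / (2 σ̂₁₁(s))`. -/
def levelMobility (s : Plane) : ℝ := 1 / (2 * secondPartial 0 0 levelTension s)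

/-- `∂_t ψ̂ = μ̂(∇ψ̂) ∑_{i,j} σ̂_{ij}(∇ψ̂) ∂²ψ̂/∂v_i∂v_j` on `V`, with initial and boundary
datum `ψ₀`. -/
def IsLevelSolution (V : Set Plane) (ψ₀ : Plane → ℝ) (ψ : Plane → ℝ → ℝ) : Prop :=
  IsClassicalSolution levelSlopes
    (fun s i j => levelMobility s * secondPartial i j levelTension s) V ψ₀ ψ

/-- `G(s) = (1 + s₂/2) [ρ₁ρ₂ - (ρ₁ + ρ₂) V(ρ)]` at `ρ = ρ(s)`. -/
def levelG (s : Plane) : ℝ :=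
  (1 + s 1 / 2) * (slopeOfLevel s 0 * slopeOfLevel s 1
    - (slopeOfLevel s 0 + slopeOfLevel s 1) * interfaceSpeed (slopeOfLevel s))

/-- The flux `(s₁/2, G(s))` of the level set equation. -/
def levelFlux (s : Plane) : Plane := !₂[s 0 / 2, levelG s]

end LozengeHydro

end

noncomputable section

namespace LozengeHydro

/-! ### Arc length of differentiable curves -/

section ArcLength

variable {E : Type*} [NormedAddCommGroup E] [NormedSpace ℝ E]

/-! Both equations have divergence form: a field `W` on slopes satisfies div W(∇ψ) = ∑ aᵢⱼ(∇ψ)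
∂ᵢ∂ⱼψ. Since the Hessian of ψ is symmetric, only the symmetric part of the Jacobian of `W` matters,
and `W` need not be a gradient. `IsParabolicFlux` records this matching, nonnegativity of the form
`a` and convexity of the set of slopes. The analysis is done once under these assumptions; the two
models enter only through the trigonometric verifications `isParabolicFlux_fluxW` and
`isParabolicFlux_levelFlux`.

Sign of the flux. Along a segment of slopes the Jacobian of `W` is nonnegative as a quadratic form,
so ⟨W x - W y, x - y⟩ ≥ 0 (`inner_sub_nonneg`). If ψ₁ ≥ ψ₂ with equality on ∂U, then at a boundary
point ∇ψ₁ - ∇ψ₂ = c n with c ≤ 0 (`gradient_eq_smul_normal`). Monotonicity in that direction gives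
the sign of the integrand pointwise, without any equation.

Drift. The order persists by the maximum principle (`comparison`). For t > 0 one differentiates
under the integral, rewrites ∂ₜ(ψ₁ - ψ₂) as the divergence of X = W(∇ψ₁) - W(∇ψ₂), and applies the
divergence theorem. Second derivatives may be unbounded near ∂U, but div X equals a time derivative
that is continuous up to the boundary; hence the divergence theorem is proved for fields continuous
on U, differentiable inside, with integrable divergence. At t = 0 the derivative is a limit from the
right, by continuity of the flux in time. Because of the order, the mutual volume is the difference
of volumes, so it decreases.

The divergence theorem is reduced by a partition of unity to boundary charts, where U lies below a
graph; an area-preserving change of variables then leads to a box. Arc length, as Hausdorff measure,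
is made explicit on graphs by `comap_hausdorffMeasure_curve`. -/

theorem exists_ball_norm_sub_bounds {γ : ℝ → E} {v : E} {x δ : ℝ}
    (h : HasStrictDerivAt γ v x) (hδ : 0 < δ) :
    ∃ r > 0, ∀ s ∈ Metric.ball x r, ∀ t ∈ Metric.ball x r,
      (‖v‖ - δ) * |s - t| ≤ ‖γ s - γ t‖ ∧ ‖γ s - γ t‖ ≤ (‖v‖ + δ) * |s - t| := by
  have h1 := h.isLittleO.def hδ
  obtain ⟨r, hr, hr'⟩ := Metric.eventually_nhds_iff_ball.1 h1
  refine ⟨r, hr, fun s hs t ht => ?_⟩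
  have h2 := hr' (s, t) (by
    rw [Metric.mem_ball, Prod.dist_eq, max_lt_iff]; exact ⟨hs, ht⟩)
  simp only [ContinuousLinearMap.toSpanSingleton_apply, Real.norm_eq_abs] at h2
  have h3 : ‖(s - t) • v‖ = ‖v‖ * |s - t| := by rw [norm_smul, Real.norm_eq_abs, mul_comm]
  have h4 := norm_sub_norm_le (γ s - γ t) ((s - t) • v)
  have h5 := norm_sub_norm_le ((s - t) • v) (γ s - γ t)
  rw [norm_sub_rev ((s - t) • v)] at h5
  constructor <;> nlinarith

variable [MeasurableSpace E] [BorelSpace E]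

/-- Near `x` the curve and its inverse are Lipschitz with constants `‖v‖ + δ` and `(‖v‖ - δ)⁻¹`, and
a Lipschitz map expands one-dimensional Hausdorff measure by at most its constant. -/
theorem hausdorffMeasure_image_curve_bounds {γ : ℝ → E} {v : E} {x δ : ℝ}
    (hγ : Function.Injective γ) (h : HasStrictDerivAt γ v x) (hδ : 0 < δ) (hδv : δ < ‖v‖) :
    ∃ r > 0, ∀ A ⊆ Metric.ball x r,
      ENNReal.ofReal (‖v‖ - δ) * volume A ≤ Measure.hausdorffMeasure 1 (γ '' A) ∧
      Measure.hausdorffMeasure 1 (γ '' A) ≤ ENNReal.ofReal (‖v‖ + δ) * volume A := by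
  obtain ⟨r, hr, hb⟩ := exists_ball_norm_sub_bounds h hδ
  refine ⟨r, hr, fun A hA => ⟨?_, ?_⟩⟩
  · have hc : 0 < ‖v‖ - δ := sub_pos.2 hδv
    have hL : LipschitzOnWith (Real.toNNReal (‖v‖ - δ)⁻¹) (Function.invFun γ) (γ '' A) := by
      refine LipschitzOnWith.of_dist_le_mul ?_
      rintro _ ⟨s, hs, rfl⟩ _ ⟨t, ht, rfl⟩
      rw [Function.leftInverse_invFun hγ, Function.leftInverse_invFun hγ, Real.dist_eq,
        dist_eq_norm, Real.coe_toNNReal _ (inv_pos.2 hc).le, inv_mul_eq_div, le_div_iff₀ hc,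
        mul_comm]
      exact (hb s (hA hs) t (hA ht)).1
    have := hL.hausdorffMeasure_image_le (d := 1) zero_le_one
    rw [(Function.leftInverse_invFun hγ).image_image, hausdorffMeasure_real,
      ENNReal.rpow_one] at this
    calc ENNReal.ofReal (‖v‖ - δ) * volume A
        ≤ ENNReal.ofReal (‖v‖ - δ) * (((‖v‖ - δ)⁻¹.toNNReal : ENNReal) *
            Measure.hausdorffMeasure 1 (γ '' A)) := by gcongr
      _ = Measure.hausdorffMeasure 1 (γ '' A) := by
        rw [← mul_assoc]
        change ENNReal.ofReal (‖v‖ - δ) * ENNReal.ofReal (‖v‖ - δ)⁻¹ * _ = _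
        rw [← ENNReal.ofReal_mul hc.le, mul_inv_cancel₀ hc.ne', ENNReal.ofReal_one, one_mul]
  · have hL : LipschitzOnWith (Real.toNNReal (‖v‖ + δ)) γ A := by
      refine LipschitzOnWith.of_dist_le_mul fun s hs t ht => ?_
      rw [Real.coe_toNNReal _ (by positivity), Real.dist_eq, dist_eq_norm]
      exact (hb s (hA hs) t (hA ht)).2
    have := hL.hausdorffMeasure_image_le (d := 1) zero_le_one
    rwa [hausdorffMeasure_real, ENNReal.rpow_one] at this

/-- The one-dimensional Hausdorff measure on a regular curve has density `‖γ'‖` with respect to the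
parameter. -/
theorem comap_hausdorffMeasure_curve {γ γ' : ℝ → E} (hγ : MeasurableEmbedding γ)
    (hd : ∀ x, HasStrictDerivAt γ (γ' x) x) (hpos : ∀ x, γ' x ≠ 0) :
    Measure.comap γ (Measure.hausdorffMeasure 1) = volume.withDensity fun x => ‖γ' x‖ₑ := by
  set ν : Measure ℝ := Measure.comap γ (Measure.hausdorffMeasure 1) with hν
  have hνA : ∀ A, ν A = Measure.hausdorffMeasure 1 (γ '' A) := fun A => hγ.comap_apply _ A
  have hpos' : ∀ x, 0 < ‖γ' x‖ := fun x => norm_pos_iff.2 (hpos x)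
  have hloc : ∀ x, ∃ r > 0, ∀ A ⊆ Metric.ball x r,
      ν A ≤ ENNReal.ofReal (‖γ' x‖ + ‖γ' x‖ / 2) * volume A := fun x => by
    obtain ⟨r, hr, h⟩ := hausdorffMeasure_image_curve_bounds hγ.injective (hd x)
      (half_pos (hpos' x)) (half_lt_self (hpos' x))
    exact ⟨r, hr, fun A hA => (hνA A).symm ▸ (h A hA).2⟩
  have hfin : IsLocallyFiniteMeasure ν := ⟨fun x => by
    obtain ⟨r, hr, h⟩ := hloc x
    refine ⟨Metric.ball x r, Metric.ball_mem_nhds x hr, (h _ subset_rfl).trans_lt ?_⟩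
    exact ENNReal.mul_lt_top ENNReal.ofReal_lt_top measure_ball_lt_top⟩
  have hac : ν ≪ volume := fun A hA => by
    refine measure_null_of_locally_null A fun x _ => ?_
    obtain ⟨r, hr, h⟩ := hloc x
    refine ⟨A ∩ Metric.ball x r,
      inter_mem_nhdsWithin A (Metric.ball_mem_nhds x hr), ?_⟩
    have h1 := h _ (inter_subset_right (s := A))
    rw [measure_mono_null inter_subset_left hA, mul_zero] at h1
    exact le_antisymm h1 bot_le
  -- By differentiation of measures the density is a.e. the limit of ν(B)/|B| over shrinking balls,
  -- which the two-sided bounds squeeze to the speed.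
  have hrn : ν.rnDeriv volume =ᵐ[volume] fun x => ‖γ' x‖ₑ := by
    filter_upwards [Besicovitch.ae_tendsto_rnDeriv ν volume] with x hx
    refine tendsto_nhds_unique hx ?_
    rw [ENNReal.tendsto_nhds enorm_ne_top]
    intro ε hε
    -- The lower bound is available only for `δ` below the speed, hence the cap at half of it.
    obtain ⟨δ, hδ, hδε, hδv⟩ : ∃ δ : ℝ, 0 < δ ∧ ENNReal.ofReal δ ≤ ε ∧ δ < ‖γ' x‖ := by
      rcases eq_or_ne ε ⊤ with rfl | hε'
      · exact ⟨‖γ' x‖ / 2, half_pos (hpos' x), le_top, half_lt_self (hpos' x)⟩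
      · have : 0 < ε.toReal := ENNReal.toReal_pos hε.ne' hε'
        refine ⟨min ε.toReal (‖γ' x‖ / 2), lt_min this (half_pos (hpos' x)), ?_,
          (min_le_right _ _).trans_lt (half_lt_self (hpos' x))⟩
        exact (ENNReal.ofReal_le_ofReal (min_le_left _ _)).trans ENNReal.ofReal_toReal_le
    obtain ⟨r, hr, h⟩ := hausdorffMeasure_image_curve_bounds hγ.injective (hd x) hδ hδv
    filter_upwards [Ioo_mem_nhdsGT hr] with s hs
    have hA := h (Metric.closedBall x s) (Metric.closedBall_subset_ball hs.2)
    rw [← hνA] at hA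
    have hv0 : volume (Metric.closedBall x s) ≠ 0 := by
      rw [Real.volume_closedBall]; simpa using hs.1
    have hvt : volume (Metric.closedBall x s) ≠ ⊤ := measure_closedBall_lt_top.ne
    rw [← ofReal_norm]
    constructor
    · rw [ENNReal.le_div_iff_mul_le (Or.inl hv0) (Or.inl hvt)]
      refine le_trans ?_ hA.1
      rw [ENNReal.ofReal_sub _ hδ.le]
      gcongr
    · rw [ENNReal.div_le_iff_le_mul (Or.inl hv0) (Or.inl hvt)]
      refine hA.2.trans ?_
      rw [ENNReal.ofReal_add (norm_nonneg _) hδ.le]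
      gcongr
  rw [← Measure.withDensity_rnDeriv_eq ν volume hac]
  exact withDensity_congr_ae hrn

end ArcLength

/-! ### Graph coordinates in the plane -/

/-- The rotation of `ν` by a right angle. -/
def perp (ν : Plane) : Plane := !₂[ν 1, -ν 0]

theorem inner_plane (x y : Plane) : inner ℝ x y = x 0 * y 0 + x 1 * y 1 := by
  simp [PiLp.inner_apply, Fin.sum_univ_two, mul_comm]

theorem norm_sq_plane (x : Plane) : ‖x‖ ^ 2 = x 0 ^ 2 + x 1 ^ 2 := by
  rw [← real_inner_self_eq_norm_sq, inner_plane]; ring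

theorem sq_add_sq_of_norm_eq_one {ν : Plane} (hν : ‖ν‖ = 1) : ν 0 ^ 2 + ν 1 ^ 2 = 1 := by
  rw [← norm_sq_plane, hν, one_pow]

@[simp] theorem perp_zero (ν : Plane) : perp ν 0 = ν 1 := rfl
@[simp] theorem perp_one (ν : Plane) : perp ν 1 = -ν 0 := rfl

theorem norm_sq_add_smul_perp {ν : Plane} (hν : ‖ν‖ = 1) (a b : ℝ) :
    ‖a • perp ν + b • ν‖ ^ 2 = a ^ 2 + b ^ 2 := by
  have h := sq_add_sq_of_norm_eq_one hν
  rw [norm_sq_plane]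
  simp only [PiLp.add_apply, PiLp.smul_apply, perp_zero, perp_one, smul_eq_mul]
  linear_combination (a ^ 2 + b ^ 2) * h

/-- The map `(x, y) ↦ p + x ν^⊥ + (y + g(x)) ν`. -/
def graphMap (p ν : Plane) (g : ℝ → ℝ) (z : ℝ × ℝ) : Plane :=
  p + (z.1 • perp ν + (z.2 + g z.1) • ν)

/-- The inverse of `graphMap`. -/
def graphInv (p ν : Plane) (g : ℝ → ℝ) (q : Plane) : ℝ × ℝ :=
  (inner ℝ (q - p) (perp ν), inner ℝ (q - p) ν - g (inner ℝ (q - p) (perp ν)))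

theorem inner_perp_self {ν : Plane} (hν : ‖ν‖ = 1) (a b : ℝ) :
    inner ℝ (a • perp ν + b • ν) (perp ν) = a := by
  have h := sq_add_sq_of_norm_eq_one hν
  rw [inner_plane]
  simp only [PiLp.add_apply, PiLp.smul_apply, perp_zero, perp_one, smul_eq_mul]
  linear_combination a * h

theorem inner_perp_normal {ν : Plane} (hν : ‖ν‖ = 1) (a b : ℝ) :
    inner ℝ (a • perp ν + b • ν) ν = b := by
  have h := sq_add_sq_of_norm_eq_one hν
  rw [inner_plane]
  simp only [PiLp.add_apply, PiLp.smul_apply, perp_zero, perp_one, smul_eq_mul]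
  linear_combination b * h

theorem inner_perp_decomposition {ν : Plane} (hν : ‖ν‖ = 1) (d : Plane) :
    inner ℝ d (perp ν) • perp ν + inner ℝ d ν • ν = d := by
  have h := sq_add_sq_of_norm_eq_one hν
  rw [inner_plane, inner_plane]
  ext i
  fin_cases i
  · simp
    linear_combination d 0 * h
  · simp
    linear_combination d 1 * h

theorem graphInv_graphMap {p ν : Plane} (hν : ‖ν‖ = 1) (g : ℝ → ℝ) (z : ℝ × ℝ) :
    graphInv p ν g (graphMap p ν g z) = z := by
  simp only [graphInv, graphMap, add_sub_cancel_left, inner_perp_self hν, inner_perp_normal hν,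
    add_sub_cancel_right]

theorem graphMap_graphInv {p ν : Plane} (hν : ‖ν‖ = 1) (g : ℝ → ℝ) (q : Plane) :
    graphMap p ν g (graphInv p ν g q) = q := by
  simp only [graphInv, graphMap, sub_add_cancel, inner_perp_decomposition hν]
  abel

/-- Graph coordinates as a homeomorphism. -/
def graphHomeo (p : Plane) {ν : Plane} (hν : ‖ν‖ = 1) {g : ℝ → ℝ} (hg : Continuous g) :
    (ℝ × ℝ) ≃ₜ Plane where
  toFun := graphMap p ν g
  invFun := graphInv p ν g
  left_inv := graphInv_graphMap hν g
  right_inv := graphMap_graphInv hν g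
  continuous_toFun := by unfold graphMap; fun_prop
  continuous_invFun := by unfold graphInv; fun_prop

/-- The derivative of `graphMap`. -/
def graphDeriv (ν : Plane) (m : ℝ) : ℝ × ℝ →L[ℝ] Plane :=
  (ContinuousLinearMap.fst ℝ ℝ ℝ).smulRight (perp ν) +
    (ContinuousLinearMap.snd ℝ ℝ ℝ + m • ContinuousLinearMap.fst ℝ ℝ ℝ).smulRight ν

@[simp] theorem graphDeriv_apply (ν : Plane) (m : ℝ) (v : ℝ × ℝ) :
    graphDeriv ν m v = v.1 • perp ν + (v.2 + m * v.1) • ν := rfl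

theorem hasFDerivAt_graphMap (p ν : Plane) {g : ℝ → ℝ} {m : ℝ} {z : ℝ × ℝ}
    (hg : HasDerivAt g m z.1) : HasFDerivAt (graphMap p ν g) (graphDeriv ν m) z := by
  unfold graphMap graphDeriv
  have h1 : HasFDerivAt (fun z : ℝ × ℝ => g z.1) (m • ContinuousLinearMap.fst ℝ ℝ ℝ) z :=
    hg.comp_hasFDerivAt z hasFDerivAt_fst
  exact ((hasFDerivAt_fst.smul_const (perp ν)).add
    ((hasFDerivAt_snd.add h1).smul_const ν)).const_add p

theorem graphDeriv_surjective {ν : Plane} (hν : ‖ν‖ = 1) (m : ℝ) :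
    Function.Surjective (graphDeriv ν m) := fun d => by
  refine ⟨(inner ℝ d (perp ν), inner ℝ d ν - m * inner ℝ d (perp ν)), ?_⟩
  simp [inner_perp_decomposition hν]

/-- The linear isometry sending the standard basis to `ν^⊥, ν`. -/
def frameIsometry {ν : Plane} (hν : ‖ν‖ = 1) : Plane →ₗᵢ[ℝ] Plane where
  toFun v := v 0 • perp ν + v 1 • ν
  map_add' v w := by simp only [PiLp.add_apply, add_smul]; abel
  map_smul' c v := by simp only [PiLp.smul_apply, smul_eq_mul, mul_smul, smul_add, RingHom.id_apply]
  norm_map' v := by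
    refine (sq_eq_sq₀ (norm_nonneg _) (norm_nonneg _)).1 ?_
    exact (norm_sq_add_smul_perp hν _ _).trans (norm_sq_plane v).symm

/-- A composition of a shear, a linear isometry and a translation; no Jacobian factor appears in the
charts. -/
theorem measurePreserving_graphMap (p : Plane) {ν : Plane} (hν : ‖ν‖ = 1) {g : ℝ → ℝ}
    (hg : Continuous g) : MeasurePreserving (graphMap p ν g) := by
  have h1 : MeasurePreserving (fun z : ℝ × ℝ => (z.1, z.2 + g z.1)) := by
    refine (MeasurePreserving.id (volume : Measure ℝ)).skew_product
      (g := fun x y => y + g x) (by fun_prop) ?_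
    exact Eventually.of_forall fun x => (measurePreserving_add_right volume (g x)).map_eq
  have h2 := (volume_preserving_finTwoArrow ℝ).symm
  have h3 := PiLp.volume_preserving_toLp (Fin 2)
  have h4 := ((frameIsometry hν).toLinearIsometryEquiv rfl).measurePreserving
  have h5 := measurePreserving_add_left (volume : Measure Plane) p
  exact h5.comp (h4.comp (h3.comp (h2.comp h1)))

/-- The graph of `g`, as a curve. -/
def graphCurve (p ν : Plane) (g : ℝ → ℝ) (x : ℝ) : Plane := graphMap p ν g (x, 0)

theorem hasStrictDerivAt_graphCurve (p ν : Plane) {g : ℝ → ℝ} {m x : ℝ}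
    (hg : HasStrictDerivAt g m x) :
    HasStrictDerivAt (graphCurve p ν g) (perp ν + m • ν) x := by
  unfold graphCurve graphMap
  have := (((hasStrictDerivAt_id x).smul_const (perp ν)).add
    ((hg.const_add 0).smul_const ν)).const_add p
  simpa using this

theorem isClosedEmbedding_graphCurve (p : Plane) {ν : Plane} (hν : ‖ν‖ = 1) {g : ℝ → ℝ}
    (hg : Continuous g) : IsClosedEmbedding (graphCurve p ν g) := by
  refine (graphHomeo p hν hg).isClosedEmbedding.comp (g := graphMap p ν g) ?_
  refine Topology.IsClosedEmbedding.of_continuous_injective_isClosedMap (by fun_prop)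
    (fun x y h => congrArg Prod.fst h) ?_
  intro K hK
  have : (fun x : ℝ => (x, (0 : ℝ))) '' K = K ×ˢ {0} := by
    ext ⟨a, b⟩; simp [eq_comm]
  rw [this]
  exact hK.prod isClosed_singleton

theorem norm_graph_tangent {ν : Plane} (hν : ‖ν‖ = 1) (m : ℝ) :
    ‖perp ν + m • ν‖ = √(1 + m ^ 2) := by
  have := norm_sq_add_smul_perp hν 1 m
  rw [one_smul, one_pow] at this
  rw [← this, Real.sqrt_sq (norm_nonneg _)]

theorem norm_graph_normal {ν : Plane} (hν : ‖ν‖ = 1) (m : ℝ) :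
    ‖ν - m • perp ν‖ = √(1 + m ^ 2) := by
  have := norm_sq_add_smul_perp hν (-m) 1
  have h2 : (-m) • perp ν + (1 : ℝ) • ν = ν - m • perp ν := by simp; abel
  rw [h2] at this
  rw [← Real.sqrt_sq (norm_nonneg (ν - _)), this]
  congr 1; ring

/-- The unit normal of the graph of `g`, pointing to the side of `ν`. -/
def graphNormal (ν : Plane) (m : ℝ) : Plane := (√(1 + m ^ 2))⁻¹ • (ν - m • perp ν)

theorem sqrt_one_add_sq_pos (m : ℝ) : 0 < √(1 + m ^ 2) := Real.sqrt_pos.2 (by positivity)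

theorem norm_graphNormal {ν : Plane} (hν : ‖ν‖ = 1) (m : ℝ) : ‖graphNormal ν m‖ = 1 := by
  rw [graphNormal, norm_smul, norm_graph_normal hν, norm_inv, Real.norm_of_nonneg
    (Real.sqrt_nonneg _), inv_mul_cancel₀ (sqrt_one_add_sq_pos m).ne']

/-- The arc-length density cancels the normalisation of the normal, so flux integrals over a graph
contain no square root. -/
theorem sqrt_smul_graphNormal (ν : Plane) (m : ℝ) :
    √(1 + m ^ 2) • graphNormal ν m = ν - m • perp ν := by
  rw [graphNormal, smul_inv_smul₀ (sqrt_one_add_sq_pos m).ne']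

theorem comap_hausdorffMeasure_graphCurve (p : Plane) {ν : Plane} (hν : ‖ν‖ = 1) {g : ℝ → ℝ}
    (hg : ContDiff ℝ 2 g) :
    Measure.comap (graphCurve p ν g) (Measure.hausdorffMeasure 1) =
      volume.withDensity fun x => ENNReal.ofReal √(1 + deriv g x ^ 2) := by
  rw [comap_hausdorffMeasure_curve
    (isClosedEmbedding_graphCurve p hν hg.continuous).measurableEmbedding
    (fun x => hasStrictDerivAt_graphCurve p ν
      (hg.contDiffAt.hasStrictDerivAt (by norm_num)))]
  · congr with x
    rw [← norm_graph_tangent hν, ofReal_norm]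
  · intro x h
    have := norm_graph_tangent hν (deriv g x)
    rw [h, norm_zero] at this
    exact (sqrt_one_add_sq_pos _).ne this

theorem setIntegral_graphCurve (p : Plane) {ν : Plane} (hν : ‖ν‖ = 1) {g : ℝ → ℝ}
    (hg : ContDiff ℝ 2 g) (h : Plane → ℝ) {s : Set ℝ} (hs : MeasurableSet s) :
    ∫ q in graphCurve p ν g '' s, h q ∂(Measure.hausdorffMeasure 1) =
      ∫ x in s, √(1 + deriv g x ^ 2) * h (graphCurve p ν g x) := by
  have hγ := (isClosedEmbedding_graphCurve p hν hg.continuous).measurableEmbedding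
  have hc : Continuous (deriv g) := hg.continuous_deriv (by norm_num)
  have h1 : (Measure.hausdorffMeasure 1 : Measure Plane).restrict (graphCurve p ν g '' s) =
      ((Measure.comap (graphCurve p ν g) (Measure.hausdorffMeasure 1)).restrict s).map
        (graphCurve p ν g) := by
    rw [← hγ.injective.preimage_image s, ← hγ.restrict_map, hγ.map_comap,
      Measure.restrict_restrict (hγ.measurableSet_image.2 hs), hγ.injective.preimage_image,
      inter_eq_left.2 (image_subset_range _ _)]
  rw [h1, hγ.integral_map, comap_hausdorffMeasure_graphCurve p hν hg]
  have := setIntegral_withDensity_eq_setIntegral_toReal_smul₀ (μ := volume) (s := s)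
    (f := fun x => ENNReal.ofReal √(1 + deriv g x ^ 2))
    (by fun_prop) (Eventually.of_forall fun _ => ENNReal.ofReal_lt_top)
    (fun x => h (graphCurve p ν g x)) hs
  rw [this]
  refine integral_congr_ae (Eventually.of_forall fun x => ?_)
  simp only [smul_eq_mul, ENNReal.toReal_ofReal (Real.sqrt_nonneg _)]

theorem hausdorffMeasure_graphCurve_Ioo_lt_top (p : Plane) {ν : Plane} (hν : ‖ν‖ = 1) {g : ℝ → ℝ}
    (hg : ContDiff ℝ 2 g) (a b : ℝ) :
    Measure.hausdorffMeasure 1 (graphCurve p ν g '' Ioo a b) < ⊤ := by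
  have hγ := (isClosedEmbedding_graphCurve p hν hg.continuous).measurableEmbedding
  have hc : Continuous (deriv g) := hg.continuous_deriv (by norm_num)
  rw [← hγ.comap_apply, comap_hausdorffMeasure_graphCurve p hν hg]
  refine (measure_mono Ioo_subset_Icc_self).trans_lt ?_
  rw [withDensity_apply _ measurableSet_Icc]
  have : IntegrableOn (fun x => √(1 + deriv g x ^ 2)) (Icc a b) :=
    (show Continuous fun x => √(1 + deriv g x ^ 2) by fun_prop).continuousOn.integrableOn_Icc
  exact this.lintegral_lt_top

/-! ### Boundary charts of a smooth closed domain -/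

/-- In graph coordinates at `p`, the set `U` is `{y ≤ 0}` within a box. -/
structure IsGraphChart (U : Set Plane) (p ν : Plane) (g : ℝ → ℝ) (δ η : ℝ) : Prop where
  norm_eq : ‖ν‖ = 1
  contDiff : ContDiff ℝ 2 g
  delta_pos : 0 < δ
  eta_pos : 0 < η
  map_zero : g 0 = 0
  mem_iff : ∀ z : ℝ × ℝ, |z.1| ≤ δ → |z.2| ≤ η → (graphMap p ν g z ∈ U ↔ z.2 ≤ 0)

/-- A bump function makes the germ global, so that the graph function of a chart is defined and `C²`
on the whole line. -/
theorem exists_contDiff_eventuallyEq {f : ℝ → ℝ} {x : ℝ} (hf : ContDiffAt ℝ 2 f x) :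
    ∃ g : ℝ → ℝ, ContDiff ℝ 2 g ∧ g =ᶠ[𝓝 x] f := by
  have h1 : ∀ᶠ y in 𝓝 x, ContDiffAt ℝ 2 f y := hf.eventually (by norm_num)
  obtain ⟨R, hR, hRf⟩ := Metric.eventually_nhds_iff_ball.1 h1
  let χ : ContDiffBump x := ⟨R / 4, R / 2, by positivity, by linarith⟩
  refine ⟨fun y => χ y * f y, contDiff_iff_contDiffAt.2 fun y => ?_, ?_⟩
  · by_cases hy : y ∈ tsupport χ
    · refine χ.contDiff.contDiffAt.mul (hRf y ?_)
      rw [χ.tsupport_eq] at hy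
      exact Metric.closedBall_subset_ball (by change R / 2 < R; linarith) hy
    · have : (fun y => χ y * f y) =ᶠ[𝓝 y] fun _ => 0 := by
        filter_upwards [notMem_tsupport_iff_eventuallyEq.1 hy] with w hw
        simp [hw]
      exact contDiffAt_const.congr_of_eventuallyEq this
  · filter_upwards [χ.eventuallyEq_one] with y hy
    simp [hy]

theorem graphMap_eq_graphMap_zero (p ν : Plane) (g : ℝ → ℝ) (z : ℝ × ℝ) :
    graphMap p ν g z = graphMap p ν (fun _ => 0) (z.1, z.2 + g z.1) := by
  simp [graphMap]

theorem exists_implicit_graph {R : ℝ × ℝ → ℝ} (hR : ContDiff ℝ 2 R) (h0 : R 0 = 0)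
    (hpos : 0 < fderiv ℝ R 0 (0, 1)) :
    ∃ g : ℝ → ℝ, ContDiff ℝ 2 g ∧ g 0 = 0 ∧ ∀ᶠ x in 𝓝 (0 : ℝ), R (x, g x) = 0 := by
  have hinv : (fderiv ℝ R 0 ∘L .inr ℝ ℝ ℝ).IsInvertible := by
    refine ⟨ContinuousLinearEquiv.unitsEquivAut ℝ (Units.mk0 _ hpos.ne'), ?_⟩
    ext
    simp
  have hc : ContDiffAt ℝ 2 R 0 := hR.contDiffAt
  obtain ⟨g, hg, hgf⟩ := exists_contDiff_eventuallyEq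
    (hc.contDiffAt_implicitFunction two_ne_zero hinv)
  refine ⟨g, hg, ?_, ?_⟩
  · exact hgf.self_of_nhds.trans (hc.implicitFunction_apply_self two_ne_zero hinv)
  · have h2 := hc.eventually_apply_implicitFunction two_ne_zero hinv
    filter_upwards [hgf, h2] with x hx hx2
    rw [hx, hx2, h0]

/-- In coordinates with `ν` along ∇r, the implicit function theorem makes {r = 0} a graph, and r
increases strictly in the direction `ν`; so {r ≤ 0} is the region below the graph. -/
theorem exists_isGraphChart {U : Set Plane} (hU : IsClosed U) (hs : HasSmoothBoundary U)
    {p : Plane} (hp : p ∈ frontier U) :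
    ∃ (ν : Plane) (g : ℝ → ℝ) (δ η : ℝ), IsGraphChart U p ν g δ η := by
  obtain ⟨r, hr, hN, hrU⟩ := hs p hp
  have hr0 : r p = 0 := by
    refine le_antisymm (hrU.self_of_nhds.1 (hU.frontier_subset hp)) (le_of_not_gt fun hlt => ?_)
    refine hp.2 (mem_interior_iff_mem_nhds.2 ?_)
    filter_upwards [hrU, hr.continuous.continuousAt.eventually_lt_const hlt] with x hx hx2
    exact hx.2 hx2.le
  set N := gradient r p with hNdef
  set ν : Plane := ‖N‖⁻¹ • N with hνdef
  have hN' : 0 < ‖N‖ := norm_pos_iff.2 hN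
  have hν : ‖ν‖ = 1 := by
    rw [hνdef, norm_smul, norm_inv, norm_norm, inv_mul_cancel₀ hN'.ne']
  set S : ℝ × ℝ → Plane := graphMap p ν fun _ => 0 with hS
  have hSd : ∀ z, HasFDerivAt S (graphDeriv ν 0) z := fun z =>
    hasFDerivAt_graphMap p ν (hasDerivAt_const _ _)
  have hSc : ContDiff ℝ 2 S := by
    rw [hS]; unfold graphMap; fun_prop
  have hS0 : S 0 = p := by simp [hS, graphMap]
  set R : ℝ × ℝ → ℝ := fun z => r (S z) with hRdef
  have hR : ContDiff ℝ 2 R := (contDiff_infty.1 hr 2).comp hSc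
  have hrd : ∀ q, HasFDerivAt r (fderiv ℝ r q) q := fun q =>
    (hr.differentiable (by simp) q).hasFDerivAt
  have hRd : ∀ z, fderiv ℝ R z = (fderiv ℝ r (S z)).comp (graphDeriv ν 0) := fun z =>
    ((hrd (S z)).comp z (hSd z)).fderiv
  have hpos : 0 < fderiv ℝ R 0 (0, 1) := by
    rw [hRd, hS0]
    have h1 : fderiv ℝ r p ν = inner ℝ N ν := by
      rw [hNdef, gradient, InnerProductSpace.toDual_symm_apply]
    simp only [ContinuousLinearMap.comp_apply, graphDeriv_apply, zero_smul, mul_zero, add_zero,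
      one_smul, zero_add, h1]
    rw [hνdef, inner_smul_right, real_inner_self_eq_norm_sq]
    positivity
  obtain ⟨g, hg, hg0, hgR⟩ := exists_implicit_graph hR (by rw [hRdef]; simp only [hS0, hr0]) hpos
  have hcont : Continuous fun z : ℝ × ℝ => fderiv ℝ R z (0, 1) := by
    have := hR.continuous_fderiv (by norm_num)
    fun_prop
  have hev : ∀ᶠ z in 𝓝 (0 : ℝ × ℝ), 0 < fderiv ℝ R z (0, 1) ∧ (S z ∈ U ↔ R z ≤ 0) := by
    refine (hcont.continuousAt.eventually_const_lt hpos).and ?_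
    have : Tendsto S (𝓝 0) (𝓝 p) := hS0 ▸ hSc.continuous.continuousAt
    exact this.eventually hrU
  obtain ⟨ε, hε, hεR⟩ := Metric.eventually_nhds_iff_ball.1 hev
  have hg_small : ∀ᶠ x in 𝓝 (0 : ℝ), |g x| < ε / 2 := by
    have : Tendsto (fun x => |g x|) (𝓝 0) (𝓝 |g 0|) := hg.continuous.abs.continuousAt
    rw [hg0, abs_zero] at this
    exact this.eventually_lt_const (half_pos hε)
  obtain ⟨δ, hδ, hδg⟩ := Metric.eventually_nhds_iff_ball.1 (hg_small.and hgR)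
  -- With |g| < ε/2 these sizes keep the height `z.2 + g z.1` within (-ε, ε), where r is monotone;
  -- the halving leaves room for the closed box in `mem_iff`.
  refine ⟨ν, g, min (δ / 2) (ε / 2), ε / 4, hν, hg, by positivity, by positivity, hg0, ?_⟩
  intro z hz1 hz2
  obtain ⟨hz1a, hz1b⟩ := le_min_iff.1 hz1
  obtain ⟨h1, h2⟩ := hδg z.1 (by rw [Metric.mem_ball, dist_zero_right, Real.norm_eq_abs]; linarith)
  have hball : ∀ y ∈ Ioo (-ε) ε, (z.1, y) ∈ Metric.ball (0 : ℝ × ℝ) ε := fun y hy => by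
    rw [Metric.mem_ball, dist_zero_right, Prod.norm_mk, max_lt_iff, Real.norm_eq_abs,
      Real.norm_eq_abs]
    exact ⟨by linarith, abs_lt.2 hy⟩
  have hmono : StrictMonoOn (fun y => R (z.1, y)) (Ioo (-ε) ε) := by
    have hder : ∀ y, HasDerivAt (fun y => R (z.1, y)) (fderiv ℝ R (z.1, y) (0, 1)) y := fun y =>
      ((hR.differentiable (by norm_num) (z.1, y)).hasFDerivAt).comp_hasDerivAt y
        ((hasDerivAt_const y z.1).prodMk (hasDerivAt_id y))
    refine strictMonoOn_of_deriv_pos (convex_Ioo _ _)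
      (fun y _ => (hder y).continuousAt.continuousWithinAt) fun y hy => ?_
    rw [interior_Ioo] at hy
    rw [(hder y).deriv]
    exact (hεR _ (hball y hy)).1
  have hgI : g z.1 ∈ Ioo (-ε) ε := abs_lt.1 (h1.trans (half_lt_self hε))
  have hyI : z.2 + g z.1 ∈ Ioo (-ε) ε := by
    rw [mem_Ioo, ← abs_lt]
    exact (abs_add_le _ _).trans_lt (by linarith)
  rw [graphMap_eq_graphMap_zero, ← hS, (hεR _ (hball _ hyI)).2, ← h2, hmono.le_iff_le hyI hgI]
  constructor <;> intro h <;> linarith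

namespace IsGraphChart

variable {U : Set Plane} {p ν : Plane} {g : ℝ → ℝ} {δ η : ℝ}

/-- The open box of graph coordinates. -/
def box (δ η : ℝ) : Set (ℝ × ℝ) := Ioo (-δ) δ ×ˢ Ioo (-η) η

theorem isOpen_box : IsOpen (box δ η) := isOpen_Ioo.prod isOpen_Ioo

/-- The coordinate neighbourhood. -/
def nhd (p ν : Plane) (g : ℝ → ℝ) (δ η : ℝ) : Set Plane := graphMap p ν g '' box δ η

variable (h : IsGraphChart U p ν g δ η)
include h

theorem continuous_map : Continuous (graphMap p ν g) :=
  (graphHomeo p h.norm_eq h.contDiff.continuous).continuous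

theorem injective_map : Function.Injective (graphMap p ν g) :=
  (graphHomeo p h.norm_eq h.contDiff.continuous).injective

theorem hasDerivAt (x : ℝ) : HasDerivAt g (deriv g x) x :=
  (h.contDiff.differentiable (by norm_num) x).hasDerivAt

theorem isOpen_image {s : Set (ℝ × ℝ)} (hs : IsOpen s) : IsOpen (graphMap p ν g '' s) :=
  (graphHomeo p h.norm_eq h.contDiff.continuous).isOpenMap s hs

theorem isOpen_nhd : IsOpen (nhd p ν g δ η) := h.isOpen_image isOpen_box

theorem mem_nhd : p ∈ nhd p ν g δ η :=
  ⟨0, ⟨⟨neg_lt_zero.2 h.delta_pos, h.delta_pos⟩, neg_lt_zero.2 h.eta_pos, h.eta_pos⟩, by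
    simp [graphMap, h.map_zero]⟩

theorem mem_iff_of_mem_box {z : ℝ × ℝ} (hz : z ∈ box δ η) : graphMap p ν g z ∈ U ↔ z.2 ≤ 0 :=
  h.mem_iff z (abs_le.2 ⟨hz.1.1.le, hz.1.2.le⟩) (abs_le.2 ⟨hz.2.1.le, hz.2.2.le⟩)

theorem mem_interior {z : ℝ × ℝ} (hz : z ∈ box δ η) (hz2 : z.2 < 0) :
    graphMap p ν g z ∈ interior U := by
  refine _root_.mem_interior.2 ⟨graphMap p ν g '' (box δ η ∩ {z | z.2 < 0}), ?_,
    h.isOpen_image (isOpen_box.inter (isOpen_lt continuous_snd continuous_const)), z, ⟨hz, hz2⟩, rfl⟩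
  rintro _ ⟨w, ⟨hw, hw2⟩, rfl⟩
  exact (h.mem_iff_of_mem_box hw).2 (le_of_lt hw2)

theorem notMem_interior {x : ℝ} (hx : x ∈ Ioo (-δ) δ) : graphCurve p ν g x ∉ interior U := by
  intro hi
  have h1 : ∀ᶠ y in 𝓝 (0 : ℝ), graphMap p ν g (x, y) ∈ U := by
    have : Tendsto (fun y : ℝ => graphMap p ν g (x, y)) (𝓝 0) (𝓝 (graphCurve p ν g x)) :=
      (h.continuous_map.comp (by fun_prop : Continuous fun y : ℝ => (x, y))).tendsto 0
    exact this (mem_interior_iff_mem_nhds.1 hi)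
  obtain ⟨ε, hε, hεU⟩ := Metric.eventually_nhds_iff_ball.1 h1
  have hm : 0 < min (ε / 2) (η / 2) := lt_min (half_pos hε) (half_pos h.eta_pos)
  have h2 := hεU (min (ε / 2) (η / 2)) (by
    rw [Metric.mem_ball, dist_zero_right, Real.norm_of_nonneg hm.le]
    linarith [min_le_left (ε / 2) (η / 2)])
  have h3 := (h.mem_iff_of_mem_box (z := (x, min (ε / 2) (η / 2))) ⟨hx, by
    constructor <;> simp only <;> linarith [min_le_right (ε / 2) (η / 2), h.eta_pos]⟩).1 h2
  exact absurd h3 (not_le.2 hm)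

theorem curve_mem {x : ℝ} (hx : x ∈ Ioo (-δ) δ) : graphCurve p ν g x ∈ U :=
  (h.mem_iff_of_mem_box ⟨hx, neg_lt_zero.2 h.eta_pos, h.eta_pos⟩).2 le_rfl

theorem frontier_inter_nhd (hU : IsClosed U) :
    frontier U ∩ nhd p ν g δ η = graphCurve p ν g '' Ioo (-δ) δ := by
  rw [hU.frontier_eq]
  apply Subset.antisymm
  · rintro _ ⟨⟨hzU, hzi⟩, z, hz, rfl⟩
    have h1 := (h.mem_iff_of_mem_box hz).1 hzU
    have h2 : ¬ z.2 < 0 := fun hlt => hzi (h.mem_interior hz hlt)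
    refine ⟨z.1, hz.1, ?_⟩
    rw [graphCurve, le_antisymm (not_lt.1 h2) h1]
  · rintro _ ⟨x, hx, rfl⟩
    exact ⟨⟨h.curve_mem hx, h.notMem_interior hx⟩, (x, 0),
      ⟨hx, neg_lt_zero.2 h.eta_pos, h.eta_pos⟩, rfl⟩

theorem inter_nhd : U ∩ nhd p ν g δ η = graphMap p ν g '' (Ioo (-δ) δ ×ˢ Ioc (-η) 0) := by
  apply Subset.antisymm
  · rintro _ ⟨hzU, z, hz, rfl⟩
    exact ⟨z, ⟨hz.1, hz.2.1, (h.mem_iff_of_mem_box hz).1 hzU⟩, rfl⟩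
  · rintro _ ⟨z, hz, rfl⟩
    have : z ∈ box δ η := ⟨hz.1, hz.2.1, hz.2.2.trans_lt h.eta_pos⟩
    exact ⟨(h.mem_iff_of_mem_box this).2 hz.2.2, z, this, rfl⟩

theorem measurableEmbedding_map : MeasurableEmbedding (graphMap p ν g) :=
  (graphHomeo p h.norm_eq h.contDiff.continuous).measurableEmbedding

theorem volume_frontier_inter_nhd (hU : IsClosed U) :
    volume (frontier U ∩ nhd p ν g δ η) = 0 := by
  have h1 : graphCurve p ν g '' Ioo (-δ) δ ⊆ graphMap p ν g '' (univ ×ˢ {0}) := by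
    rintro _ ⟨x, _, rfl⟩
    exact ⟨(x, 0), by simp, rfl⟩
  rw [h.frontier_inter_nhd hU]
  refine measure_mono_null h1 ?_
  rw [← (measurePreserving_graphMap p h.norm_eq h.contDiff.continuous).measure_preimage_emb
    h.measurableEmbedding_map, h.injective_map.preimage_image, Measure.volume_eq_prod,
    Measure.prod_prod]
  simp

/-- The property holds on the top edge of a half-open box and is carried over by `graphMap`, whose
derivative is onto. It makes gradients up to the boundary meaningful. -/
theorem uniqueDiffWithinAt {x : ℝ} (hx : x ∈ Ioo (-δ) δ) :
    UniqueDiffWithinAt ℝ U (graphCurve p ν g x) := by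
  have h1 : UniqueDiffWithinAt ℝ (Ioo (-δ) δ ×ˢ Ioc (-η) 0) (x, (0 : ℝ)) :=
    (isOpen_Ioo.uniqueDiffWithinAt hx).prod
      (uniqueDiffOn_Ioc (-η) 0 0 ⟨neg_lt_zero.2 h.eta_pos, le_rfl⟩)
  have h2 := (hasFDerivAt_graphMap p ν (z := (x, 0))
    (h.hasDerivAt x)).hasFDerivWithinAt.uniqueDiffWithinAt h1 (graphDeriv_surjective h.norm_eq _).denseRange
  refine h2.mono ?_
  rw [← h.inter_nhd]
  exact inter_subset_left

/-- Along a ray in direction `d` the height above the graph vanishes at t = 0, and its derivative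
there is a positive multiple of the inner product of `d` with the normal; its sign for small t > 0
decides membership in `U`. -/
theorem isExteriorNormal {x : ℝ} (hx : x ∈ Ioo (-δ) δ) :
    IsExteriorNormal U (graphCurve p ν g x) (graphNormal ν (deriv g x)) := by
  have key : ∀ d : Plane, ∀ t : ℝ, graphCurve p ν g x + t • d =
      graphMap p ν g (x + t * inner ℝ d (perp ν),
        g x + t * inner ℝ d ν - g (x + t * inner ℝ d (perp ν))) := fun d t => by
    conv_lhs => rw [← inner_perp_decomposition h.norm_eq d]
    simp only [graphCurve, graphMap, smul_add, smul_smul, zero_add, add_smul, sub_add_cancel]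
    abel
  have hinner : ∀ d : Plane, inner ℝ d (graphNormal ν (deriv g x)) =
      (√(1 + deriv g x ^ 2))⁻¹ * (inner ℝ d ν - deriv g x * inner ℝ d (perp ν)) := fun d => by
    rw [graphNormal, inner_smul_right, inner_sub_right, inner_smul_right]
  have hsq := inv_pos.2 (sqrt_one_add_sq_pos (deriv g x))
  have hder : ∀ d : Plane, HasDerivAt (fun t : ℝ => g x + t * inner ℝ d ν -
      g (x + t * inner ℝ d (perp ν))) (inner ℝ d ν - deriv g x * inner ℝ d (perp ν)) 0 := fun d => by
    have h1 : HasDerivAt (fun t : ℝ => x + t * inner ℝ d (perp ν)) (inner ℝ d (perp ν)) 0 := by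
      simpa using ((hasDerivAt_id (0 : ℝ)).mul_const (inner ℝ d (perp ν))).const_add x
    have h2 : HasDerivAt (fun t : ℝ => g x + t * inner ℝ d ν) (inner ℝ d ν) 0 := by
      simpa using ((hasDerivAt_id (0 : ℝ)).mul_const (inner ℝ d ν)).const_add (g x)
    have h3 : HasDerivAt g (deriv g x) (x + 0 * inner ℝ d (perp ν)) := by
      simpa using h.hasDerivAt x
    exact h2.sub (h3.comp 0 h1)
  have hbox : ∀ d : Plane, ∀ᶠ t in 𝓝[>] (0 : ℝ), (x + t * inner ℝ d (perp ν),
        g x + t * inner ℝ d ν - g (x + t * inner ℝ d (perp ν))) ∈ box δ η := fun d => by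
    have hc : Continuous fun t : ℝ => (x + t * inner ℝ d (perp ν),
        g x + t * inner ℝ d ν - g (x + t * inner ℝ d (perp ν))) := by
      have := h.contDiff.continuous
      fun_prop
    refine (hc.continuousAt.eventually (isOpen_box.mem_nhds ?_)).filter_mono nhdsWithin_le_nhds
    simpa using ⟨hx, ⟨neg_lt_zero.2 h.eta_pos, h.eta_pos⟩⟩
  refine ⟨norm_graphNormal h.norm_eq _, fun d hd => ?_, fun d hd => ?_⟩
  · rw [hinner] at hd
    have hd' : inner ℝ d ν - deriv g x * inner ℝ d (perp ν) < 0 := by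
      by_contra hcon
      exact absurd hd (not_lt.2 (mul_nonneg hsq.le (not_lt.1 hcon)))
    have h1 := (hasDerivAt_iff_tendsto_slope.1 (hder d)).mono_left
      (nhdsWithin_mono 0 (fun t (ht : 0 < t) => ht.ne'))
    filter_upwards [hbox d, h1.eventually_lt_const hd', self_mem_nhdsWithin] with t ht1 ht2 ht3
    rw [key, h.mem_iff_of_mem_box ht1]
    have ht3' : 0 < t := ht3
    rw [slope_def_field, div_lt_iff₀ (by simpa using ht3')] at ht2
    simp at ht2
    simpa using ht2.le
  · rw [hinner] at hd
    have hd' : 0 < inner ℝ d ν - deriv g x * inner ℝ d (perp ν) := by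
      by_contra hcon
      exact absurd hd (not_lt.2 (mul_nonpos_of_nonneg_of_nonpos hsq.le (not_lt.1 hcon)))
    have h1 := (hasDerivAt_iff_tendsto_slope.1 (hder d)).mono_left
      (nhdsWithin_mono 0 (fun t (ht : 0 < t) => ht.ne'))
    filter_upwards [hbox d, h1.eventually_const_lt hd', self_mem_nhdsWithin] with t ht1 ht2 ht3
    rw [key, h.mem_iff_of_mem_box ht1]
    have ht3' : 0 < t := ht3
    rw [slope_def_field, lt_div_iff₀ (by simpa using ht3')] at ht2
    simp at ht2
    simpa using ht2

end IsGraphChart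

/-- For distinct unit vectors, `ν' - ν` makes an obtuse angle with `ν` and an acute one with `ν'`,
so the ray in that direction would lie both inside and outside `U`. This identifies the chosen
`exteriorNormal` with the normal of the graph. -/
theorem IsExteriorNormal.unique {U : Set Plane} {p ν ν' : Plane} (h : IsExteriorNormal U p ν)
    (h' : IsExteriorNormal U p ν') : ν = ν' := by
  by_contra hne
  have hlt : inner ℝ ν ν' < 1 :=
    (inner_lt_one_iff_real_of_norm_eq_one h.1 h'.1).2 hne
  have h1 : inner ℝ (ν' - ν) ν < 0 := by
    rw [inner_sub_left, real_inner_self_eq_norm_sq, h.1, real_inner_comm]; linarith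
  have h2 : 0 < inner ℝ (ν' - ν) ν' := by
    rw [inner_sub_left, real_inner_self_eq_norm_sq, h'.1]; linarith
  obtain ⟨t, ht, ht'⟩ := ((h.2.1 _ h1).and (h'.2.2 _ h2)).exists
  exact ht' ht

theorem IsExteriorNormal.eq_exteriorNormal {U : Set Plane} {p ν : Plane}
    (h : IsExteriorNormal U p ν) : exteriorNormal U p = ν :=
  (Classical.epsilon_spec (p := IsExteriorNormal U p) ⟨ν, h⟩).unique h

theorem IsGraphChart.exteriorNormal_eq {U : Set Plane} {p ν : Plane} {g : ℝ → ℝ} {δ η : ℝ}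
    (h : IsGraphChart U p ν g δ η) {x : ℝ} (hx : x ∈ Ioo (-δ) δ) :
    exteriorNormal U (graphCurve p ν g x) = graphNormal ν (deriv g x) :=
  (h.isExteriorNormal hx).eq_exteriorNormal

/-! ### Consequences for smooth closed domains -/

namespace IsSmoothClosedDomain

variable {U : Set Plane} (hU : IsSmoothClosedDomain U)
include hU

theorem isClosed : IsClosed U := hU.isCompact.isClosed

theorem frontier_subset : frontier U ⊆ U := hU.isClosed.frontier_subset

theorem isCompact_frontier : IsCompact (frontier U) :=
  hU.isCompact.of_isClosed_subset isClosed_frontier hU.frontier_subset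

theorem exists_chart {p : Plane} (hp : p ∈ frontier U) :
    ∃ (ν : Plane) (g : ℝ → ℝ) (δ η : ℝ), IsGraphChart U p ν g δ η :=
  exists_isGraphChart hU.isClosed hU.smooth hp

theorem uniqueDiffOn : UniqueDiffOn ℝ U := fun p hp => by
  by_cases hpi : p ∈ interior U
  · exact uniqueDiffWithinAt_of_mem_nhds (mem_interior_iff_mem_nhds.1 hpi)
  · obtain ⟨ν, g, δ, η, h⟩ := hU.exists_chart ⟨subset_closure hp, hpi⟩
    have := h.uniqueDiffWithinAt (x := 0) ⟨neg_lt_zero.2 h.delta_pos, h.delta_pos⟩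
    simpa [graphCurve, graphMap, h.map_zero] using this

theorem isExteriorNormal_exteriorNormal {p : Plane} (hp : p ∈ frontier U) :
    IsExteriorNormal U p (exteriorNormal U p) := by
  obtain ⟨ν, g, δ, η, h⟩ := hU.exists_chart hp
  have := h.isExteriorNormal (x := 0) ⟨neg_lt_zero.2 h.delta_pos, h.delta_pos⟩
  simp only [graphCurve, graphMap, h.map_zero, zero_smul, add_zero] at this
  rwa [this.eq_exteriorNormal]

theorem volume_frontier : volume (frontier U) = 0 := by
  refine measure_null_of_locally_null _ fun p hp => ?_
  obtain ⟨ν, g, δ, η, h⟩ := hU.exists_chart hp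
  exact ⟨_, inter_mem_nhdsWithin _ (h.isOpen_nhd.mem_nhds h.mem_nhd),
    h.volume_frontier_inter_nhd hU.isClosed⟩

/-- Lets integrals over `U` use identities known only in the interior. -/
theorem interior_ae_eq : interior U =ᵐ[volume] U :=
  interior_ae_eq_of_null_frontier hU.volume_frontier

theorem hausdorffMeasure_frontier_lt_top :
    Measure.hausdorffMeasure 1 (frontier U) < ⊤ := by
  refine hU.isCompact_frontier.measure_lt_top_of_nhdsWithin fun p hp => ?_
  obtain ⟨ν, g, δ, η, h⟩ := hU.exists_chart hp
  refine ⟨_, inter_mem_nhdsWithin _ (h.isOpen_nhd.mem_nhds h.mem_nhd), ?_⟩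
  rw [h.frontier_inter_nhd hU.isClosed]
  exact hausdorffMeasure_graphCurve_Ioo_lt_top p h.norm_eq h.contDiff _ _

theorem continuousOn_exteriorNormal : ContinuousOn (exteriorNormal U) (frontier U) := by
  intro p hp
  obtain ⟨ν, g, δ, η, h⟩ := hU.exists_chart hp
  have hN := h.isOpen_nhd.mem_nhds h.mem_nhd
  have hg : Continuous (deriv g) := h.contDiff.continuous_deriv (by norm_num)
  refine ContinuousWithinAt.mono_of_mem_nhdsWithin (t := frontier U ∩ IsGraphChart.nhd p ν g δ η) ?_
    (inter_mem_nhdsWithin _ hN)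
  have hc : Continuous fun q => graphNormal ν (deriv g (inner ℝ (q - p) (perp ν))) := by
    unfold graphNormal
    have : ∀ q : Plane, √(1 + deriv g (inner ℝ (q - p) (perp ν)) ^ 2) ≠ 0 := fun q =>
      (sqrt_one_add_sq_pos _).ne'
    fun_prop (disch := assumption)
  have heq : EqOn (exteriorNormal U) (fun q => graphNormal ν (deriv g (inner ℝ (q - p) (perp ν))))
      (frontier U ∩ IsGraphChart.nhd p ν g δ η) := by
    rw [h.frontier_inter_nhd hU.isClosed]
    rintro _ ⟨x, hx, rfl⟩
    simp only [h.exteriorNormal_eq hx]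
    have := congrArg Prod.fst (graphInv_graphMap (p := p) h.norm_eq g (x, 0))
    simp only [graphInv] at this
    rw [graphCurve, this]
  exact hc.continuousWithinAt.congr heq (heq ⟨hp, h.mem_nhd⟩)

theorem continuousOn_normalComponent {F : Plane → Plane} (hF : ContinuousOn F (frontier U)) :
    ContinuousOn (normalComponent U F) (frontier U) :=
  hF.inner hU.continuousOn_exteriorNormal

theorem isFiniteMeasure_restrict_frontier :
    IsFiniteMeasure ((Measure.hausdorffMeasure 1).restrict (frontier U)) :=
  ⟨by rw [Measure.restrict_apply_univ]; exact hU.hausdorffMeasure_frontier_lt_top⟩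

theorem integrableOn_frontier {f : Plane → ℝ} (hf : ContinuousOn f (frontier U)) :
    IntegrableOn f (frontier U) (Measure.hausdorffMeasure 1) := by
  have := hU.isFiniteMeasure_restrict_frontier
  obtain ⟨C, hC⟩ := hU.isCompact_frontier.exists_bound_of_continuousOn hf
  refine Integrable.of_bound
    (hf.aestronglyMeasurable_of_isCompact hU.isCompact_frontier isClosed_frontier.measurableSet) C ?_
  filter_upwards [ae_restrict_mem isClosed_frontier.measurableSet] with q hq using hC q hq

theorem integrableOn_normalComponent {F : Plane → Plane} (hF : ContinuousOn F (frontier U)) :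
    IntegrableOn (normalComponent U F) (frontier U) (Measure.hausdorffMeasure 1) :=
  hU.integrableOn_frontier (hU.continuousOn_normalComponent hF)

end IsSmoothClosedDomain

/-! ### The divergence theorem -/

/-- The divergence of a vector field. -/
def divergence (X : Plane → Plane) (x : Plane) : ℝ :=
  ∑ i, (fderiv ℝ X x (EuclideanSpace.single i 1)) i

/-- The trace does not depend on the orthonormal basis. -/
theorem divergence_eq_inner (X : Plane → Plane) (x : Plane) {ν : Plane} (hν : ‖ν‖ = 1) :
    divergence X x =
      inner ℝ (fderiv ℝ X x (perp ν)) (perp ν) + inner ℝ (fderiv ℝ X x ν) ν := by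
  have h := sq_add_sq_of_norm_eq_one hν
  set A := fderiv ℝ X x
  have hb : ∀ v : Plane, v = v 0 • EuclideanSpace.single 0 1 + v 1 • EuclideanSpace.single 1 1 :=
    fun v => by ext i; fin_cases i <;> simp
  have hA : ∀ v : Plane, A v = v 0 • A (EuclideanSpace.single 0 1) +
      v 1 • A (EuclideanSpace.single 1 1) := fun v => by
    conv_lhs => rw [hb v]
    rw [map_add, map_smul, map_smul]
  rw [divergence, Fin.sum_univ_two, hA (perp ν), hA ν, inner_plane, inner_plane]
  simp only [PiLp.add_apply, PiLp.smul_apply, perp_zero, perp_one, smul_eq_mul]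
  linear_combination (-(A (EuclideanSpace.single 0 1) 0) - A (EuclideanSpace.single 1 1) 1) * h

theorem divergence_eq_zero_of_eventuallyEq {X : Plane → Plane} {q : Plane} (h : X =ᶠ[𝓝 q] 0) :
    divergence X q = 0 := by
  simp [divergence, h.fderiv_eq]

/-- The divergence theorem on the image of a box under graph coordinates. -/
theorem integral_divergence_graphMap_box {X : Plane → Plane} (p : Plane) {ν : Plane}
    (hν : ‖ν‖ = 1) {g : ℝ → ℝ} (hg : ContDiff ℝ 2 g) {a b : ℝ × ℝ} (hab : a ≤ b)
    (hc : ContinuousOn (fun z => X (graphMap p ν g z)) (Icc a b))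
    (hd : ∀ z ∈ Ioo a.1 b.1 ×ˢ Ioo a.2 b.2, DifferentiableAt ℝ X (graphMap p ν g z))
    (hi : IntegrableOn (fun z => divergence X (graphMap p ν g z)) (Icc a b)) :
    ∫ z in Icc a b, divergence X (graphMap p ν g z) =
      (((∫ x in a.1..b.1, inner ℝ (X (graphMap p ν g (x, b.2))) (ν - deriv g x • perp ν)) -
        ∫ x in a.1..b.1, inner ℝ (X (graphMap p ν g (x, a.2))) (ν - deriv g x • perp ν)) +
        ∫ y in a.2..b.2, inner ℝ (X (graphMap p ν g (b.1, y))) (perp ν)) -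
        ∫ y in a.2..b.2, inner ℝ (X (graphMap p ν g (a.1, y))) (perp ν) := by
  have hg1 : ∀ x, HasDerivAt g (deriv g x) x := fun x =>
    (hg.differentiable (by norm_num) x).hasDerivAt
  have hg' : ContDiff ℝ 1 (deriv g) :=
    ((contDiff_succ_iff_deriv (n := 1)).1 (by rw [one_add_one_eq_two]; exact hg)).2.2
  have hg2 : ∀ x, HasDerivAt (deriv g) (deriv (deriv g) x) x := fun x =>
    (hg'.differentiable (by norm_num) x).hasDerivAt
  set D : ℝ × ℝ → ℝ × ℝ →L[ℝ] Plane := fun z =>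
    (fderiv ℝ X (graphMap p ν g z)).comp (graphDeriv ν (deriv g z.1)) with hD
  set N' : ℝ × ℝ → ℝ × ℝ →L[ℝ] Plane := fun z =>
    -((deriv (deriv g) z.1 • ContinuousLinearMap.fst ℝ ℝ ℝ).smulRight (perp ν)) with hN'
  have hXd : ∀ z ∈ Ioo a.1 b.1 ×ˢ Ioo a.2 b.2,
      HasFDerivAt (fun z => X (graphMap p ν g z)) (D z) z := fun z hz =>
    (hd z hz).hasFDerivAt.comp z (hasFDerivAt_graphMap p ν (hg1 z.1))
  have hNd : ∀ z : ℝ × ℝ, HasFDerivAt (fun z : ℝ × ℝ => ν - deriv g z.1 • perp ν) (N' z) z :=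
    fun z => (((hg2 z.1).comp_hasFDerivAt z hasFDerivAt_fst).smul_const (perp ν)).const_sub ν
  -- In chart coordinates X has components ⟨X, ν^⊥⟩ and ⟨X, ν - g'ν^⊥⟩. The two terms with g' cancel
  -- in the divergence, and g'' does not enter because the second component is differentiated only
  -- in y.
  have hdiv : ∀ z : ℝ × ℝ, divergence X (graphMap p ν g z) =
      ((fderivInnerCLM ℝ (X (graphMap p ν g z), perp ν)).comp
        ((D z).prod (0 : ℝ × ℝ →L[ℝ] Plane))) (1, 0) +
      ((fderivInnerCLM ℝ (X (graphMap p ν g z), ν - deriv g z.1 • perp ν)).comp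
        ((D z).prod (N' z))) (0, 1) := fun z => by
    rw [divergence_eq_inner X _ hν]
    simp [hD, hN', inner_sub_right, inner_add_left, inner_smul_left, inner_smul_right]
  simp only [hdiv] at hi ⊢
  refine integral_divergence_prod_Icc_of_hasFDerivAt_of_le
    (fun z => inner ℝ (X (graphMap p ν g z)) (perp ν))
    (fun z => inner ℝ (X (graphMap p ν g z)) (ν - deriv g z.1 • perp ν)) _ _ a b hab
    (hc.inner continuousOn_const) (hc.inner ?_) (fun z hz => ?_) (fun z hz => ?_) hi
  · have := hg'.continuous
    fun_prop
  · exact (hXd z hz).inner ℝ (hasFDerivAt_const _ _)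
  · exact (hXd z hz).inner ℝ (hNd z)

theorem Ioo_prod_Ioc_ae_eq_Icc (a b : ℝ × ℝ) :
    (Ioo a.1 b.1 ×ˢ Ioc a.2 b.2 : Set (ℝ × ℝ)) =ᵐ[volume] Icc a b := by
  rw [Icc_prod_eq]
  exact Measure.set_prod_ae_eq Ioo_ae_eq_Icc Ioc_ae_eq_Icc

theorem Ioo_prod_Ioo_ae_eq_Icc (a b : ℝ × ℝ) :
    (Ioo a.1 b.1 ×ˢ Ioo a.2 b.2 : Set (ℝ × ℝ)) =ᵐ[volume] Icc a b := by
  rw [Icc_prod_eq]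
  exact Measure.set_prod_ae_eq Ioo_ae_eq_Icc Ioo_ae_eq_Icc

/-- The divergence theorem for a vector field supported in a boundary chart. -/
theorem IsGraphChart.integral_divergence {U : Set Plane} {p ν : Plane} {g : ℝ → ℝ} {δ η : ℝ}
    (h : IsGraphChart U p ν g δ η) (hU : IsClosed U) {X : Plane → Plane}
    (hc : ContinuousOn X U) (hd : ∀ x ∈ interior U, DifferentiableAt ℝ X x)
    (hi : IntegrableOn (divergence X) (interior U))
    (hX : ∀ q ∉ nhd p ν g δ η, X =ᶠ[𝓝 q] 0) :
    ∫ q in U, divergence X q = boundaryFlux U X := by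
  have hX0 : ∀ q ∉ nhd p ν g δ η, X q = 0 := fun q hq => (hX q hq).self_of_nhds
  have hmp := measurePreserving_graphMap p h.norm_eq h.contDiff.continuous
  have hη : -η < 0 := neg_lt_zero.2 h.eta_pos
  have hδ : -δ < δ := neg_lt_self h.delta_pos
  have hab : ((-δ, -η) : ℝ × ℝ) ≤ (δ, 0) := ⟨hδ.le, hη.le⟩
  have hside : ∀ z : ℝ × ℝ, z ∉ box δ η → X (graphMap p ν g z) = 0 := fun z hz =>
    hX0 _ fun ⟨w, hw, hwz⟩ => hz (h.injective_map hwz ▸ hw)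
  have hint : ∀ z ∈ Ioo (-δ) δ ×ˢ Ioo (-η) 0, graphMap p ν g z ∈ interior U := fun z hz =>
    h.mem_interior ⟨hz.1, hz.2.1, hz.2.2.trans h.eta_pos⟩ hz.2.2
  have hflux : boundaryFlux U X = ∫ x in (-δ)..δ,
      inner ℝ (X (graphMap p ν g (x, 0))) (ν - deriv g x • perp ν) := by
    rw [boundaryFlux, setIntegral_eq_of_subset_of_forall_sdiff_eq_zero
      (s := frontier U ∩ nhd p ν g δ η) isClosed_frontier.measurableSet inter_subset_left,
      h.frontier_inter_nhd hU, setIntegral_graphCurve p h.norm_eq h.contDiff _ measurableSet_Ioo,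
      intervalIntegral.integral_of_le hδ.le, integral_Ioc_eq_integral_Ioo]
    · refine setIntegral_congr_fun measurableSet_Ioo fun x hx => ?_
      simp only [normalComponent, h.exteriorNormal_eq hx]
      rw [← inner_smul_right, sqrt_smul_graphNormal]
      rfl
    · intro q hq
      simp [normalComponent, hX0 q fun hqn => hq.2 ⟨hq.1, hqn⟩]
  have hbox := integral_divergence_graphMap_box (X := X) p h.norm_eq h.contDiff hab
    (hc.comp h.continuous_map.continuousOn fun z hz => ?_) (fun z hz => hd _ (hint z hz)) ?_
  -- The field vanishes on the bottom and on both sides of the box; only the top edge y = 0, which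
  -- is the boundary of `U`, contributes.
  · have e1 : ∀ x, X (graphMap p ν g (x, -η)) = 0 := fun x =>
      hside _ fun hz => absurd hz.2.1 (lt_irrefl _)
    have e2 : ∀ y, X (graphMap p ν g (δ, y)) = 0 := fun y =>
      hside _ fun hz => absurd hz.1.2 (lt_irrefl _)
    have e3 : ∀ y, X (graphMap p ν g (-δ, y)) = 0 := fun y =>
      hside _ fun hz => absurd hz.1.1 (lt_irrefl _)
    simp only [e1, e2, e3, inner_zero_left, intervalIntegral.integral_zero, sub_zero,
      add_zero] at hbox
    rw [hflux, ← hbox, setIntegral_eq_of_subset_of_forall_sdiff_eq_zero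
      (s := U ∩ nhd p ν g δ η) hU.measurableSet inter_subset_left, h.inter_nhd,
      hmp.setIntegral_image_emb h.measurableEmbedding_map]
    · exact setIntegral_congr_set (Ioo_prod_Ioc_ae_eq_Icc (-δ, -η) (δ, 0))
    · intro q hq
      exact divergence_eq_zero_of_eventuallyEq (hX q fun hqn => hq.2 ⟨hq.1, hqn⟩)
  · refine (h.mem_iff z (abs_le.2 ⟨hz.1.1, hz.2.1⟩) (abs_le.2 ⟨hz.1.2, ?_⟩)).2 hz.2.2
    exact hz.2.2.trans h.eta_pos.le
  · refine IntegrableOn.congr_set_ae ?_ (Ioo_prod_Ioo_ae_eq_Icc (-δ, -η) (δ, 0)).symm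
    refine (hmp.integrableOn_image h.measurableEmbedding_map).1 (hi.mono_set ?_)
    rintro _ ⟨z, hz, rfl⟩
    exact hint z hz

/-- The integral of the divergence of a vector field supported in the interior vanishes. -/
theorem integral_divergence_eq_zero {U : Set Plane} (hU : IsCompact U) {X : Plane → Plane}
    (hd : ∀ x ∈ interior U, DifferentiableAt ℝ X x)
    (hi : IntegrableOn (divergence X) (interior U))
    (hX : ∀ q ∉ interior U, X =ᶠ[𝓝 q] 0) :
    ∫ q in U, divergence X q = 0 := by
  have hdiff : Differentiable ℝ X := fun q => by
    by_cases hq : q ∈ interior U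
    · exact hd q hq
    · exact (differentiableAt_const (0 : Plane)).congr_of_eventuallyEq (hX q hq)
  have hX0 : ∀ q ∉ U, X q = 0 := fun q hq => (hX q fun h => hq (interior_subset h)).self_of_nhds
  have hD0 : ∀ q ∉ interior U, divergence X q = 0 := fun q hq =>
    divergence_eq_zero_of_eventuallyEq (hX q hq)
  have hiU : Integrable (divergence X) := by
    rw [← integrableOn_univ]
    exact hi.of_forall_sdiff_eq_zero MeasurableSet.univ fun q hq => hD0 q hq.2
  obtain ⟨R, hR⟩ := hU.isBounded.subset_ball 0
  -- The flat chart with g = 0, on a square so large that X vanishes on all four sides.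
  set ν : Plane := EuclideanSpace.single 1 1 with hνdef
  have hν : ‖ν‖ = 1 := by simp [hνdef]
  have hmp := measurePreserving_graphMap 0 hν (g := fun _ => 0) continuous_const
  have hemb : MeasurableEmbedding (graphMap 0 ν fun _ => 0) :=
    (graphHomeo 0 hν continuous_const).measurableEmbedding
  have hnorm : ∀ z : ℝ × ℝ, ‖graphMap 0 ν (fun _ => 0) z‖ ^ 2 = z.1 ^ 2 + z.2 ^ 2 := fun z => by
    simp [graphMap, norm_sq_add_smul_perp hν]
  have hout : ∀ z : ℝ × ℝ, (|R| ≤ |z.1| ∨ |R| ≤ |z.2|) → graphMap 0 ν (fun _ => 0) z ∉ U := by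
    intro z hz hzU
    have h1 : ‖graphMap 0 ν (fun _ => 0) z‖ < R := by simpa using hR hzU
    have h2 := hnorm z
    have h3 : ‖graphMap 0 ν (fun _ => 0) z‖ ^ 2 < R ^ 2 := by gcongr
    rcases hz with hz | hz <;> nlinarith [sq_le_sq.2 hz, sq_nonneg z.1, sq_nonneg z.2]
  -- The absolute value covers empty `U`, where `R` may be negative.
  have hab : ((-|R|, -|R|) : ℝ × ℝ) ≤ (|R|, |R|) := by
    constructor <;> simp
  have hbox := integral_divergence_graphMap_box (X := X) 0 hν (g := fun _ => 0) contDiff_const hab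
    (hdiff.continuous.comp (graphHomeo 0 hν continuous_const).continuous).continuousOn
    (fun z _ => hdiff _) ((hmp.integrable_comp_emb hemb).2 hiU).integrableOn
  have e1 : ∀ x, X (graphMap 0 ν (fun _ => 0) (x, |R|)) = 0 := fun x => hX0 _ (hout _ (by simp))
  have e2 : ∀ x, X (graphMap 0 ν (fun _ => 0) (x, -|R|)) = 0 := fun x => hX0 _ (hout _ (by simp))
  have e3 : ∀ y, X (graphMap 0 ν (fun _ => 0) (|R|, y)) = 0 := fun y => hX0 _ (hout _ (by simp))
  have e4 : ∀ y, X (graphMap 0 ν (fun _ => 0) (-|R|, y)) = 0 := fun y => hX0 _ (hout _ (by simp))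
  simp only [e1, e2, e3, e4, inner_zero_left, intervalIntegral.integral_zero, sub_zero,
      add_zero] at hbox
  rw [← hmp.setIntegral_image_emb hemb] at hbox
  rw [← hbox]
  refine (setIntegral_eq_of_subset_of_forall_sdiff_eq_zero
    (hemb.measurableSet_image.2 measurableSet_Icc) (fun q hq => ?_)
    fun q hq => hD0 q fun hqi => hq.2 (interior_subset hqi)).symm
  refine ⟨graphInv 0 ν (fun _ => 0) q, ?_, graphMap_graphInv hν _ q⟩
  by_contra hcon
  refine hout (graphInv 0 ν (fun _ => 0) q) ?_ (by rwa [graphMap_graphInv hν])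
  by_contra hcon2
  push Not at hcon2
  have h1 := abs_lt.1 hcon2.1
  have h2 := abs_lt.1 hcon2.2
  exact hcon ⟨⟨h1.1.le, h2.1.le⟩, ⟨h1.2.le, h2.2.le⟩⟩

theorem divergence_smul {χ : Plane → ℝ} {X : Plane → Plane} {x : Plane}
    (hχ : DifferentiableAt ℝ χ x) (hX : DifferentiableAt ℝ X x) :
    divergence (fun y => χ y • X y) x =
      χ x * divergence X x + ∑ i, fderiv ℝ χ x (EuclideanSpace.single i 1) * X x i := by
  have h : fderiv ℝ (fun y => χ y • X y) x = χ x • fderiv ℝ X x + (fderiv ℝ χ x).smulRight (X x) :=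
    fderiv_fun_smul hχ hX
  simp only [divergence, h, Fin.sum_univ_two]
  simp
  ring

theorem divergence_sum {ι : Type*} (s : Finset ι) {X : ι → Plane → Plane} {x : Plane}
    (hX : ∀ i ∈ s, DifferentiableAt ℝ (X i) x) :
    divergence (fun y => ∑ i ∈ s, X i y) x = ∑ i ∈ s, divergence (X i) x := by
  simp only [divergence, fderiv_fun_sum hX]
  rw [Finset.sum_comm]
  simp

open scoped Manifold in
/-- A finite smooth partition of unity subordinate to boundary charts and the interior. -/
theorem IsSmoothClosedDomain.exists_partition {U : Set Plane} (hU : IsSmoothClosedDomain U) :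
    ∃ (ι : Type) (_ : Fintype ι) (χ : ι → Plane → ℝ),
      (∀ i, ContDiff ℝ ∞ (χ i)) ∧ (∀ i x, |χ i x| ≤ 1) ∧ (∀ x ∈ U, ∑ i, χ i x = 1) ∧
      ∀ i, tsupport (χ i) ⊆ interior U ∨ ∃ p ν g δ η, IsGraphChart U p ν g δ η ∧
        tsupport (χ i) ⊆ IsGraphChart.nhd p ν g δ η := by
  choose! ν g δ η hch using fun p (hp : p ∈ frontier U) => hU.exists_chart hp
  set N : Plane → Set Plane := fun p => IsGraphChart.nhd p (ν p) (g p) (δ p) (η p) with hN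
  obtain ⟨t, ht, htU⟩ := hU.isCompact_frontier.elim_nhds_subcover N
    fun p hp => (hch p hp).isOpen_nhd.mem_nhds (hch p hp).mem_nhd
  let O : Option t → Set Plane := fun i => i.elim (interior U) fun p => N p
  have hO : ∀ i, IsOpen (O i) := by
    rintro (_ | p)
    · exact isOpen_interior
    · exact (hch p (ht p p.2)).isOpen_nhd
  have hcov : U ⊆ ⋃ i, O i := fun x hx => by
    by_cases hxi : x ∈ interior U
    · exact mem_iUnion.2 ⟨none, hxi⟩
    · obtain ⟨p, hp, hxp⟩ := mem_iUnion₂.1 (htU ⟨subset_closure hx, hxi⟩)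
      exact mem_iUnion.2 ⟨some ⟨p, hp⟩, hxp⟩
  obtain ⟨χ, hχ⟩ := SmoothPartitionOfUnity.exists_isSubordinate (𝓘(ℝ, Plane)) hU.isClosed O hO hcov
  refine ⟨Option t, inferInstance, fun i => χ i, fun i => (χ i).contMDiff.contDiff, fun i x => ?_,
    fun x hx => ?_, ?_⟩
  · rw [abs_of_nonneg (χ.nonneg i x)]
    exact χ.le_one i x
  · rw [← finsum_eq_sum_of_fintype]
    exact χ.sum_eq_one hx
  · rintro (_ | p)
    · exact Or.inl (hχ none)
    · exact Or.inr ⟨p, _, _, _, _, hch p (ht p p.2), hχ (some p)⟩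

/-- The divergence theorem on a smooth closed domain. -/
theorem IsSmoothClosedDomain.integral_divergence {U : Set Plane} (hU : IsSmoothClosedDomain U)
    {X : Plane → Plane} (hc : ContinuousOn X U) (hd : ∀ x ∈ interior U, DifferentiableAt ℝ X x)
    (hi : IntegrableOn (divergence X) (interior U)) :
    ∫ q in U, divergence X q = boundaryFlux U X := by
  obtain ⟨ι, _, χ, hχ, hχ1, hχs, hχt⟩ := hU.exists_partition
  have hχd : ∀ i x, DifferentiableAt ℝ (χ i) x := fun i x =>
    (hχ i).differentiable (by simp) x
  set Y : ι → Plane → Plane := fun i x => χ i x • X x with hY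
  have hYc : ∀ i, ContinuousOn (Y i) U := fun i => (hχ i).continuous.continuousOn.smul hc
  have hYd : ∀ i, ∀ x ∈ interior U, DifferentiableAt ℝ (Y i) x := fun i x hx =>
    (hχd i x).smul (hd x hx)
  -- By the product rule: a bounded factor times an integrable divergence, plus a term continuous on
  -- the compact set `U`.
  have hYi : ∀ i, IntegrableOn (divergence (Y i)) (interior U) := fun i => by
    have h1 : IntegrableOn (fun x => χ i x * divergence X x) (interior U) :=
      Integrable.bdd_mul hi (hχ i).continuous.aestronglyMeasurable
        (Eventually.of_forall fun x => hχ1 i x)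
    have h2 : IntegrableOn
        (fun x => ∑ j, fderiv ℝ (χ i) x (EuclideanSpace.single j 1) * X x j) (interior U) := by
      refine IntegrableOn.mono_set (ContinuousOn.integrableOn_compact hU.isCompact ?_)
        interior_subset
      have := (hχ i).continuous_fderiv (by simp)
      fun_prop
    refine (h1.add h2).congr ?_
    filter_upwards [ae_restrict_mem isOpen_interior.measurableSet] with x hx
    exact (divergence_smul (hχd i x) (hd x hx)).symm
  have hsupp : ∀ i x, x ∉ tsupport (χ i) → Y i =ᶠ[𝓝 x] 0 := fun i x hx => by
    filter_upwards [notMem_tsupport_iff_eventuallyEq.1 hx] with y hy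
    simp [hY, hy]
  have hpiece : ∀ i, ∫ q in U, divergence (Y i) q = boundaryFlux U (Y i) := fun i => by
    rcases hχt i with hint | ⟨p, ν, g, δ, η, hch, hsub⟩
    · have hs : ∀ q ∉ interior U, Y i =ᶠ[𝓝 q] 0 := fun q hq => hsupp i q fun h => hq (hint h)
      rw [integral_divergence_eq_zero hU.isCompact (hYd i) (hYi i) hs, boundaryFlux]
      refine (setIntegral_eq_zero_of_forall_eq_zero fun q hq => ?_).symm
      simp [normalComponent, (hs q hq.2).self_of_nhds]
    · exact hch.integral_divergence hU.isClosed (hYc i) (hYd i) (hYi i)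
        fun q hq => hsupp i q fun h => hq (hsub h)
  have hsum : ∀ x ∈ U, ∑ i, Y i x = X x := fun x hx => by
    rw [← Finset.sum_smul, hχs x hx, one_smul]
  -- The cutoffs sum to 1 only on `U`, so this identity is differentiated in the open interior and
  -- the null boundary is discarded.
  have hL : ∫ q in U, divergence X q = ∑ i, ∫ q in U, divergence (Y i) q := by
    simp only [← setIntegral_congr_set hU.interior_ae_eq]
    rw [← integral_finsetSum _ fun i _ => hYi i]
    refine setIntegral_congr_fun isOpen_interior.measurableSet fun x hx => ?_
    rw [← divergence_sum _ fun i _ => hYd i x hx]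
    have : (fun y => ∑ i, Y i y) =ᶠ[𝓝 x] X := by
      filter_upwards [isOpen_interior.mem_nhds hx] with y hy using hsum y (interior_subset hy)
    simp only [divergence, this.fderiv_eq]
  have hR : boundaryFlux U X = ∑ i, boundaryFlux U (Y i) := by
    simp only [boundaryFlux]
    rw [← integral_finsetSum _ fun i _ =>
      hU.integrableOn_normalComponent ((hYc i).mono hU.frontier_subset)]
    refine setIntegral_congr_fun isClosed_frontier.measurableSet fun x hx => ?_
    simp only [normalComponent]
    rw [← sum_inner, hsum x (hU.frontier_subset hx)]
  rw [hL, hR]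
  exact Finset.sum_congr rfl fun i _ => hpiece i

/-! ### Monotone fluxes -/

/-- `W` is a flux for the operator `∑ a_{ij}(∇ψ) ∂_i∂_j ψ`: the symmetric part of the derivative of `W`
is that of `a`, and the form `a` is nonnegative on the convex set `S` of slopes. -/
structure IsParabolicFlux (S : Set Plane) (a : Plane → Fin 2 → Fin 2 → ℝ) (W : Plane → Plane) :
    Prop where
  convex : Convex ℝ S
  differentiableAt : ∀ ρ ∈ S, DifferentiableAt ℝ W ρ
  deriv_zero_zero : ∀ ρ ∈ S, fderiv ℝ W ρ (EuclideanSpace.single 0 1) 0 = a ρ 0 0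
  deriv_one_one : ∀ ρ ∈ S, fderiv ℝ W ρ (EuclideanSpace.single 1 1) 1 = a ρ 1 1
  deriv_off_diag : ∀ ρ ∈ S, fderiv ℝ W ρ (EuclideanSpace.single 1 1) 0 +
    fderiv ℝ W ρ (EuclideanSpace.single 0 1) 1 = a ρ 0 1 + a ρ 1 0
  nonneg : ∀ ρ ∈ S, ∀ x y : ℝ, 0 ≤ a ρ 0 0 * x ^ 2 + (a ρ 0 1 + a ρ 1 0) * (x * y) + a ρ 1 1 * y ^ 2

theorem eq_smul_single_add (v : Plane) :
    v = v 0 • EuclideanSpace.single 0 (1 : ℝ) + v 1 • EuclideanSpace.single 1 (1 : ℝ) := by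
  ext i; fin_cases i <;> simp

theorem map_plane {F : Type*} [NormedAddCommGroup F] [NormedSpace ℝ F] (A : Plane →L[ℝ] F)
    (v : Plane) : A v =
      v 0 • A (EuclideanSpace.single 0 1) + v 1 • A (EuclideanSpace.single 1 1) := by
  conv_lhs => rw [eq_smul_single_add v]
  rw [map_add, map_smul, map_smul]

namespace IsParabolicFlux

variable {S : Set Plane} {a : Plane → Fin 2 → Fin 2 → ℝ} {W : Plane → Plane}
  (h : IsParabolicFlux S a W)
include h

theorem continuousOn : ContinuousOn W S := fun ρ hρ =>
  (h.differentiableAt ρ hρ).continuousAt.continuousWithinAt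

theorem inner_fderiv_nonneg {ρ : Plane} (hρ : ρ ∈ S) (v : Plane) :
    0 ≤ inner ℝ (fderiv ℝ W ρ v) v := by
  have h1 := h.nonneg ρ hρ (v 0) (v 1)
  rw [map_plane, inner_plane]
  simp only [PiLp.add_apply, PiLp.smul_apply, smul_eq_mul]
  rw [← h.deriv_off_diag ρ hρ, ← h.deriv_zero_zero ρ hρ, ← h.deriv_one_one ρ hρ] at h1
  linarith

/-- The mean value theorem for s ↦ ⟨W(y + s(x - y)), x - y⟩; convexity keeps the segment in `S`. -/
theorem inner_sub_nonneg {x y : Plane} (hx : x ∈ S) (hy : y ∈ S) :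
    0 ≤ inner ℝ (W x - W y) (x - y) := by
  have hmem : ∀ s ∈ Icc (0 : ℝ) 1, y + s • (x - y) ∈ S := fun s hs =>
    h.convex.add_smul_sub_mem hy hx hs
  have hder : ∀ s ∈ Icc (0 : ℝ) 1, HasDerivAt (fun s : ℝ => inner ℝ (W (y + s • (x - y))) (x - y))
      (inner ℝ (fderiv ℝ W (y + s • (x - y)) (x - y)) (x - y)) s := fun s hs => by
    have h1 : HasDerivAt (fun s : ℝ => y + s • (x - y)) (x - y) s := by
      simpa using ((hasDerivAt_id s).smul_const (x - y)).const_add y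
    have h2 := (h.differentiableAt _ (hmem s hs)).hasFDerivAt.comp_hasDerivAt s h1
    simpa using h2.inner ℝ (hasDerivAt_const s (x - y))
  obtain ⟨c, hc, hce⟩ := exists_hasDerivAt_eq_slope _ _ zero_lt_one
    (fun s hs => (hder s hs).continuousAt.continuousWithinAt)
    fun s hs => hder s (Ioo_subset_Icc_self hs)
  have h3 := h.inner_fderiv_nonneg (hmem c (Ioo_subset_Icc_self hc)) (x - y)
  rw [hce] at h3
  simpa [← inner_sub_left] using h3

end IsParabolicFlux

/-! ### Gradients of ordered functions at a boundary contact point -/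

theorem inner_gradient_nonneg_of_inward {U : Set Plane} {p ν d G : Plane} {w : Plane → ℝ}
    (hn : IsExteriorNormal U p ν) (hw : HasGradientWithinAt w G U p) (hpos : ∀ u ∈ U, 0 ≤ w u)
    (h0 : w p = 0) (hd : inner ℝ d ν < 0) : 0 ≤ inner ℝ G d := by
  have h1 : HasDerivWithinAt (fun t : ℝ => p + t • d) d {t | p + t • d ∈ U} 0 := by
    simpa using (((hasDerivAt_id (0 : ℝ)).smul_const d).const_add p).hasDerivWithinAt
  have h2 : HasFDerivWithinAt w (InnerProductSpace.toDual ℝ Plane G) U (p + (0 : ℝ) • d) := by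
    simpa using hw.hasFDerivWithinAt
  have h3 := (h2.comp_hasDerivWithinAt 0 h1 fun t ht => ht).mono_of_mem_nhdsWithin
    (hn.2.1 d hd)
  rw [hasDerivWithinAt_iff_tendsto_slope' (by simp)] at h3
  refine ge_of_tendsto h3 ?_
  filter_upwards [hn.2.1 d hd, self_mem_nhdsWithin] with t ht ht0
  rw [slope_def_field]
  simp only [Function.comp_apply, zero_smul, add_zero, sub_zero, h0]
  exact div_nonneg (hpos _ ht) (le_of_lt ht0)

/-- `G` is nonnegative against every strictly inward direction. Testing with -εν - H, where H is the
tangential part of `G`, gives ‖H‖² ≤ -εc for all ε > 0, which forces both c ≤ 0 and H = 0. -/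
theorem gradient_eq_smul_normal {U : Set Plane} {p ν G : Plane} {w : Plane → ℝ}
    (hn : IsExteriorNormal U p ν) (hw : HasGradientWithinAt w G U p) (hpos : ∀ u ∈ U, 0 ≤ w u)
    (h0 : w p = 0) : ∃ c : ℝ, c ≤ 0 ∧ G = c • ν := by
  have key := fun d hd => inner_gradient_nonneg_of_inward (d := d) hn hw hpos h0 hd
  have hνν : inner ℝ ν ν = (1 : ℝ) := by rw [real_inner_self_eq_norm_sq, hn.1, one_pow]
  set c := inner ℝ G ν with hc
  set H := G - c • ν with hH
  have hHν : inner ℝ H ν = 0 := by rw [hH, inner_sub_left, inner_smul_left, hνν]; simp [hc]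
  have hGH : inner ℝ G H = ‖H‖ ^ 2 := by
    have : G = H + c • ν := by rw [hH]; abel
    rw [this, inner_add_left, inner_smul_left, real_inner_comm, real_inner_self_eq_norm_sq,
      real_inner_comm, hHν]
    simp
  have hε : ∀ ε : ℝ, 0 < ε → ‖H‖ ^ 2 ≤ ε * (-c) := fun ε hε => by
    have h1 := key (-(ε • ν) - H) (by
      rw [inner_sub_left, inner_neg_left, inner_smul_left, hνν, hHν]; simpa using hε)
    rw [inner_sub_right, inner_neg_right, inner_smul_right, hGH, ← hc] at h1
    linarith
  have hc0 : c ≤ 0 := by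
    have := hε 1 one_pos
    nlinarith [sq_nonneg ‖H‖]
  refine ⟨c, hc0, sub_eq_zero.1 (norm_eq_zero.1 ?_)⟩
  by_contra hne
  have hpos2 : 0 < ‖H‖ ^ 2 := by positivity
  -- Chosen so that ε(-c) ≤ ‖H‖²/2; the denominator is positive because c ≤ 0.
  have := hε (‖H‖ ^ 2 / (2 * (1 - c))) (by apply div_pos hpos2; linarith)
  rw [div_mul_eq_mul_div, le_div_iff₀ (by linarith)] at this
  nlinarith

theorem IsParabolicFlux.inner_normal_nonpos {S : Set Plane} {a : Plane → Fin 2 → Fin 2 → ℝ}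
    {W : Plane → Plane} (h : IsParabolicFlux S a W) {x y ν : Plane} (hx : x ∈ S) (hy : y ∈ S)
    {c : ℝ} (hc : c ≤ 0) (hxy : x - y = c • ν) : inner ℝ (W x - W y) ν ≤ 0 := by
  rcases hc.lt_or_eq with hc | hc
  · have h1 := h.inner_sub_nonneg hx hy
    rw [hxy, inner_smul_right] at h1
    by_contra hcon
    nlinarith [not_le.1 hcon]
  · rw [hc, zero_smul, sub_eq_zero] at hxy
    simp [hxy]

theorem continuousOn_gradientWithin {U : Set Plane} (hU : UniqueDiffOn ℝ U) {ψ : Plane → ℝ}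
    (hψ : ContDiffOn ℝ 1 ψ U) : ContinuousOn (gradientWithin ψ U) U :=
  (InnerProductSpace.toDual ℝ Plane).symm.continuous.comp_continuousOn
    (hψ.continuousOn_fderivWithin hU le_rfl)

theorem IsParabolicFlux.boundaryFlux_nonpos {S : Set Plane} {a : Plane → Fin 2 → Fin 2 → ℝ}
    {W : Plane → Plane} (h : IsParabolicFlux S a W) {U : Set Plane}
    (hU : IsSmoothClosedDomain U) {ψ₁ ψ₂ : Plane → ℝ} (h₁ : ContDiffOn ℝ 1 ψ₁ U)
    (h₂ : ContDiffOn ℝ 1 ψ₂ U) (hS₁ : ∀ u ∈ U, gradientWithin ψ₁ U u ∈ S)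
    (hS₂ : ∀ u ∈ U, gradientWithin ψ₂ U u ∈ S) (hle : ∀ u ∈ U, ψ₂ u ≤ ψ₁ u)
    (heq : ∀ u ∈ frontier U, ψ₁ u = ψ₂ u) :
    IntegrableOn (normalComponent U fun u =>
        W (gradientWithin ψ₁ U u) - W (gradientWithin ψ₂ U u))
      (frontier U) (Measure.hausdorffMeasure 1) ∧
    boundaryFlux U (fun u => W (gradientWithin ψ₁ U u) - W (gradientWithin ψ₂ U u)) ≤ 0 := by
  have hUd := hU.uniqueDiffOn
  constructor
  · refine hU.integrableOn_normalComponent (ContinuousOn.mono ?_ hU.frontier_subset)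
    exact (h.continuousOn.comp (continuousOn_gradientWithin hUd h₁) hS₁).sub
      (h.continuousOn.comp (continuousOn_gradientWithin hUd h₂) hS₂)
  · refine setIntegral_nonpos isClosed_frontier.measurableSet fun p hp => ?_
    have hpU := hU.frontier_subset hp
    have g₁ := ((h₁.differentiableOn one_ne_zero) p hpU).hasGradientWithinAt
    have g₂ := ((h₂.differentiableOn one_ne_zero) p hpU).hasGradientWithinAt
    have g : HasGradientWithinAt (fun u => ψ₁ u - ψ₂ u)
        (gradientWithin ψ₁ U p - gradientWithin ψ₂ U p) U p := by
      rw [hasGradientWithinAt_iff_hasFDerivWithinAt, map_sub]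
      exact g₁.hasFDerivWithinAt.sub g₂.hasFDerivWithinAt
    obtain ⟨c, hc, hce⟩ := gradient_eq_smul_normal (hU.isExteriorNormal_exteriorNormal hp) g
      (fun u hu => sub_nonneg.2 (hle u hu)) (sub_eq_zero.2 (heq p hp))
    exact h.inner_normal_nonpos (hS₁ p hpU) (hS₂ p hpU) hc hce

/-! ### Second derivatives -/

theorem differentiableAt_fderiv {f : Plane → ℝ} {x : Plane} (hf : ContDiffAt ℝ 2 f x) :
    DifferentiableAt ℝ (fderiv ℝ f) x :=
  (hf.fderiv_right (m := 1) (by norm_num [one_add_one_eq_two])).differentiableAt one_ne_zero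

theorem secondPartial_eq {f : Plane → ℝ} {x : Plane} (hf : ContDiffAt ℝ 2 f x) (i j : Fin 2) :
    secondPartial i j f x =
      fderiv ℝ (fderiv ℝ f) x (EuclideanSpace.single i 1) (EuclideanSpace.single j 1) := by
  have h1 : HasFDerivAt (partialDeriv j f)
      ((ContinuousLinearMap.apply ℝ ℝ (EuclideanSpace.single j (1 : ℝ))).comp
        (fderiv ℝ (fderiv ℝ f) x)) x :=
    (ContinuousLinearMap.apply ℝ ℝ (EuclideanSpace.single j (1 : ℝ))).hasFDerivAt.comp x
      (differentiableAt_fderiv hf).hasFDerivAt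
  rw [secondPartial, partialDeriv, h1.fderiv]
  rfl

theorem secondPartial_comm {f : Plane → ℝ} {x : Plane} (hf : ContDiffAt ℝ 2 f x) (i j : Fin 2) :
    secondPartial i j f x = secondPartial j i f x := by
  rw [secondPartial_eq hf, secondPartial_eq hf]
  exact hf.isSymmSndFDerivAt (by simp) _ _

theorem secondPartial_sub {f g : Plane → ℝ} {x : Plane} (hf : ContDiffAt ℝ 2 f x)
    (hg : ContDiffAt ℝ 2 g x) (i j : Fin 2) :
    secondPartial i j (fun y => f y - g y) x = secondPartial i j f x - secondPartial i j g x := by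
  rw [secondPartial_eq hf, secondPartial_eq hg, secondPartial_eq (hf.sub hg)]
  have : fderiv ℝ (fun y => f y - g y) =ᶠ[𝓝 x] fun y => fderiv ℝ f y - fderiv ℝ g y := by
    filter_upwards [hf.eventually (by norm_num), hg.eventually (by norm_num)] with y hy hy'
    exact fderiv_fun_sub (hy.differentiableAt two_ne_zero) (hy'.differentiableAt two_ne_zero)
  rw [this.fderiv_eq, fderiv_fun_sub (differentiableAt_fderiv hf) (differentiableAt_fderiv hg)]
  rfl

/-- A negative second derivative would make the point a local maximum too, so φ would be locally
constant, with vanishing second derivative. -/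
theorem deriv_deriv_nonneg_of_isLocalMin {φ : ℝ → ℝ} {x : ℝ} (h : IsLocalMin φ x)
    (hc : ContinuousAt φ x) : 0 ≤ deriv (deriv φ) x := by
  by_contra hcon
  have hmax := isLocalMax_of_deriv_deriv_neg (not_le.1 hcon) h.deriv_eq_zero hc
  have hconst : φ =ᶠ[𝓝 x] fun _ => φ x := by
    filter_upwards [h, hmax] with y h1 h2 using le_antisymm h2 h1
  have h1 := hconst.deriv.deriv_eq
  simp only [deriv_const'] at h1
  exact hcon h1.ge

theorem hessian_nonneg_of_isLocalMin {f : Plane → ℝ} {x : Plane} (hf : ContDiffAt ℝ 2 f x)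
    (h : IsLocalMin f x) (v : Plane) : 0 ≤ fderiv ℝ (fderiv ℝ f) x v v := by
  have hline : ∀ s : ℝ, HasDerivAt (fun s : ℝ => x + s • v) v s := fun s => by
    simpa using ((hasDerivAt_id s).smul_const v).const_add x
  have hline0 : Tendsto (fun s : ℝ => x + s • v) (𝓝 0) (𝓝 x) := by
    simpa using (hline 0).continuousAt.tendsto
  have hmin : IsLocalMin (fun s : ℝ => f (x + s • v)) 0 := by
    have := hline0.eventually h
    filter_upwards [this] with s hs
    simpa using hs
  have hd1 : deriv (fun s : ℝ => f (x + s • v)) =ᶠ[𝓝 0] fun s => fderiv ℝ f (x + s • v) v := by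
    filter_upwards [hline0.eventually (hf.eventually (by norm_num))] with s hs
    exact ((hs.differentiableAt two_ne_zero).hasFDerivAt.comp_hasDerivAt s (hline s)).deriv
  have hd2 : HasDerivAt (fun s : ℝ => fderiv ℝ f (x + s • v) v)
      (fderiv ℝ (fderiv ℝ f) x v v) 0 := by
    have h1 : HasFDerivAt (fderiv ℝ f) (fderiv ℝ (fderiv ℝ f) x) (x + (0 : ℝ) • v) := by
      simpa using (differentiableAt_fderiv hf).hasFDerivAt
    have h2 := h1.comp_hasDerivAt 0 (hline 0)
    simpa using h2.clm_apply (hasDerivAt_const (0 : ℝ) v)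
  have hc : ContinuousAt (fun s : ℝ => f (x + s • v)) 0 := by
    refine ContinuousAt.comp (g := f) ?_ (hline 0).continuousAt
    simpa using hf.continuousAt
  have := deriv_deriv_nonneg_of_isLocalMin hmin hc
  rwa [hd1.deriv_eq, hd2.deriv] at this

/-- The trace of the product of two nonnegative forms in two variables is nonnegative. -/
theorem trace_mul_nonneg {a b c p q r : ℝ}
    (h1 : ∀ x y : ℝ, 0 ≤ a * x ^ 2 + b * (x * y) + c * y ^ 2)
    (h2 : ∀ x y : ℝ, 0 ≤ p * x ^ 2 + 2 * q * (x * y) + r * y ^ 2) : 0 ≤ a * p + b * q + c * r := by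
  have hp : 0 ≤ p := by simpa using h2 1 0
  have hr : 0 ≤ r := by simpa using h2 0 1
  have hc : 0 ≤ c := by simpa using h1 0 1
  -- If p = 0, nonnegativity of the second form forces q = 0. Otherwise p times the trace is the
  -- first form at (p, q) plus c(pr - q²).
  rcases hp.eq_or_lt with hp | hp
  · have hq : q = 0 := by
      by_contra hq
      -- At this vector the second form, with p = 0, equals -1.
      have := h2 (-(r + 1) / (2 * q)) 1
      have e : 2 * q * (-(r + 1) / (2 * q) * 1) = -(r + 1) := by field_simp
      rw [e, ← hp] at this
      linarith
    rw [← hp, hq]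
    nlinarith [mul_nonneg hc hr]
  · have hdet : 0 ≤ p * r - q ^ 2 := by
      have := h2 (-q) p
      have e : p * (-q) ^ 2 + 2 * q * (-q * p) + r * p ^ 2 = p * (p * r - q ^ 2) := by ring
      rw [e] at this
      exact nonneg_of_mul_nonneg_right this hp
    have h3 := h1 p q
    have h4 := mul_nonneg hc hdet
    have : 0 ≤ p * (a * p + b * q + c * r) := by nlinarith
    exact nonneg_of_mul_nonneg_right this hp

/-! ### Integrals depending on time -/

/-- The measure is left general so that the statement serves both area on `U` and arc length on its
boundary. -/
theorem continuousOn_setIntegral_param {K : Set Plane} (hK : IsCompact K) {μ : Measure Plane}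
    [IsFiniteMeasure (μ.restrict K)] {f : Plane → ℝ → ℝ}
    (hf : ContinuousOn (fun q : Plane × ℝ => f q.1 q.2) (K ×ˢ Ici 0)) :
    ContinuousOn (fun t => ∫ u in K, f u t ∂μ) (Ici 0) := by
  intro t₀ ht₀
  have hsub : K ×ˢ Icc 0 (t₀ + 1) ⊆ K ×ˢ Ici (0 : ℝ) := prod_mono_right Icc_subset_Ici_self
  obtain ⟨C, hC⟩ := (hK.prod (isCompact_Icc (a := (0 : ℝ)) (b := t₀ + 1))).exists_bound_of_continuousOn
    (hf.mono hsub)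
  have hsec : ∀ t ∈ Ici (0 : ℝ), ContinuousOn (fun u => f u t) K := fun t ht =>
    hf.comp (by fun_prop : ContinuousOn (fun u : Plane => (u, t)) K) fun u hu => ⟨hu, ht⟩
  have hev : ∀ᶠ t in 𝓝[Ici 0] t₀, t ∈ Icc 0 (t₀ + 1) := by
    filter_upwards [self_mem_nhdsWithin, mem_nhdsWithin_of_mem_nhds (Iic_mem_nhds (lt_add_one t₀))]
      with t h1 h2 using ⟨h1, h2⟩
  refine continuousWithinAt_of_dominated (bound := fun _ => C) ?_ ?_ (integrable_const C) ?_
  · filter_upwards [self_mem_nhdsWithin] with t ht using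
      (hsec t ht).aestronglyMeasurable_of_isCompact hK hK.measurableSet
  · filter_upwards [hev] with t ht
    filter_upwards [ae_restrict_mem hK.measurableSet] with u hu using hC (u, t) ⟨hu, ht⟩
  · filter_upwards [ae_restrict_mem hK.measurableSet] with u hu
    exact (hf.comp (by fun_prop : ContinuousOn (fun t : ℝ => (u, t)) (Ici 0))
      (fun t ht => ⟨hu, ht⟩)) t₀ ht₀

theorem hasDerivAt_setIntegral_param {K : Set Plane} (hK : IsCompact K) {f f' : Plane → ℝ → ℝ}
    (hf : ContinuousOn (fun q : Plane × ℝ => f q.1 q.2) (K ×ˢ Ici 0))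
    (hf' : ContinuousOn (fun q : Plane × ℝ => f' q.1 q.2) (K ×ˢ Ici 0))
    (hd : ∀ u ∈ K, ∀ t, 0 < t → HasDerivAt (f u) (f' u t) t) {t₀ : ℝ} (ht₀ : 0 < t₀) :
    HasDerivAt (fun t => ∫ u in K, f u t) (∫ u in K, f' u t₀) t₀ := by
  have hsub : K ×ˢ Icc 0 (t₀ + 1) ⊆ K ×ˢ Ici (0 : ℝ) := prod_mono_right Icc_subset_Ici_self
  obtain ⟨C, hC⟩ := (hK.prod (isCompact_Icc (a := (0 : ℝ)) (b := t₀ + 1))).exists_bound_of_continuousOn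
    (hf'.mono hsub)
  have hsec : ∀ {h : Plane → ℝ → ℝ}, ContinuousOn (fun q : Plane × ℝ => h q.1 q.2) (K ×ˢ Ici 0) →
      ∀ t ∈ Ici (0 : ℝ), ContinuousOn (fun u => h u t) K := fun hh t ht =>
    hh.comp (by fun_prop : ContinuousOn (fun u : Plane => (u, t)) K) fun u hu => ⟨hu, ht⟩
  have hfin : IsFiniteMeasure ((volume : Measure Plane).restrict K) :=
    ⟨by rw [Measure.restrict_apply_univ]; exact hK.measure_lt_top⟩
  refine (hasDerivAt_integral_of_dominated_loc_of_deriv_le (bound := fun _ => C)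
    (Ioo_mem_nhds ht₀ (lt_add_one t₀)) (F := fun t u => f u t) (F' := fun t u => f' u t) ?_
    ((hsec hf t₀ ht₀.le).integrableOn_compact hK)
    ((hsec hf' t₀ ht₀.le).aestronglyMeasurable_of_isCompact hK hK.measurableSet) ?_
    (integrable_const C) ?_).2
  · filter_upwards [Ioi_mem_nhds ht₀] with t ht using
      (hsec hf t (mem_Ici.2 (le_of_lt ht))).aestronglyMeasurable_of_isCompact hK hK.measurableSet
  · filter_upwards [ae_restrict_mem hK.measurableSet] with u hu t ht using
      hC (u, t) ⟨hu, ht.1.le, ht.2.le⟩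
  · filter_upwards [ae_restrict_mem hK.measurableSet] with u hu t ht using hd u hu t ht.1

/-! ### Classical solutions -/

/-- The time derivative up to the boundary. -/
def timeDeriv (U : Set Plane) (ψ : Plane → ℝ → ℝ) (u : Plane) (t : ℝ) : ℝ :=
  fderivWithin ℝ (fun p : Plane × ℝ => ψ p.1 p.2) (U ×ˢ Ici (0 : ℝ)) (u, t) (0, 1)

theorem inner_gradient_single {f : Plane → ℝ} (x : Plane) (i : Fin 2) :
    gradient f x i = partialDeriv i f x := by
  have h : inner ℝ (gradient f x) (EuclideanSpace.single i (1 : ℝ)) = partialDeriv i f x := by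
    rw [gradient, InnerProductSpace.toDual_symm_apply, partialDeriv]
  rw [← h, EuclideanSpace.inner_single_right]
  simp

theorem spaceGrad_eq_gradient {U : Set Plane} (ψ : Plane → ℝ → ℝ) (t : ℝ) {u : Plane}
    (hu : u ∈ interior U) : spaceGrad U ψ t u = gradient (fun v => ψ v t) u := by
  rw [spaceGrad, gradientWithin, gradient,
    fderivWithin_of_mem_nhds (mem_interior_iff_mem_nhds.1 hu)]

theorem hasFDerivAt_gradient {f : Plane → ℝ} {x : Plane} (hf : ContDiffAt ℝ 2 f x) :
    DifferentiableAt ℝ (gradient f) x ∧ ∀ i j : Fin 2,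
      fderiv ℝ (gradient f) x (EuclideanSpace.single i 1) j = secondPartial i j f x := by
  have hd : DifferentiableAt ℝ (gradient f) x :=
    ((InnerProductSpace.toDual ℝ Plane).symm.toContinuousLinearEquiv.toContinuousLinearMap
      |>.differentiableAt).comp x (differentiableAt_fderiv hf)
  refine ⟨hd, fun i j => ?_⟩
  have h1 : HasFDerivAt (fun y => gradient f y j)
      ((EuclideanSpace.proj j : Plane →L[ℝ] ℝ).comp (fderiv ℝ (gradient f) x)) x :=
    (EuclideanSpace.proj j : Plane →L[ℝ] ℝ).hasFDerivAt.comp x hd.hasFDerivAt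
  rw [secondPartial]
  nth_rw 1 [partialDeriv]
  have h2 : partialDeriv j f = fun y => gradient f y j := by
    funext y; rw [inner_gradient_single]
  rw [h2, h1.fderiv]
  rfl

/-- By the chain rule the divergence is the trace of the Jacobian of `W` times the Hessian of `f`;
symmetry of the Hessian leaves only the symmetric part of the Jacobian, which is that of `a`. -/
theorem IsParabolicFlux.divergence_comp_gradient {S : Set Plane}
    {a : Plane → Fin 2 → Fin 2 → ℝ} {W : Plane → Plane} (h : IsParabolicFlux S a W)
    {f : Plane → ℝ} {x : Plane} (hf : ContDiffAt ℝ 2 f x) (hS : gradient f x ∈ S) :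
    DifferentiableAt ℝ (fun y => W (gradient f y)) x ∧
    divergence (fun y => W (gradient f y)) x =
      ∑ i, ∑ j, a (gradient f x) i j * secondPartial i j f x := by
  obtain ⟨hd, hH⟩ := hasFDerivAt_gradient hf
  have hW := h.differentiableAt _ hS
  refine ⟨hW.comp x hd, ?_⟩
  have hfd : fderiv ℝ (fun y => W (gradient f y)) x =
      (fderiv ℝ W (gradient f x)).comp (fderiv ℝ (gradient f) x) := fderiv_comp x hW hd
  rw [divergence, hfd]
  simp only [Fin.sum_univ_two, ContinuousLinearMap.comp_apply]
  rw [map_plane (fderiv ℝ W (gradient f x)) (fderiv ℝ (gradient f) x (EuclideanSpace.single 0 1)),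
    map_plane (fderiv ℝ W (gradient f x)) (fderiv ℝ (gradient f) x (EuclideanSpace.single 1 1))]
  simp only [hH, PiLp.add_apply, PiLp.smul_apply, smul_eq_mul]
  rw [h.deriv_zero_zero _ hS, h.deriv_one_one _ hS, secondPartial_comm hf 1 0]
  linear_combination secondPartial 0 1 f x * h.deriv_off_diag _ hS

namespace IsClassicalSolution

variable {S : Set Plane} {a : Plane → Fin 2 → Fin 2 → ℝ} {U : Set Plane} {ψ₀ : Plane → ℝ}
  {ψ : Plane → ℝ → ℝ} (hψ : IsClassicalSolution S a U ψ₀ ψ) (hU : IsSmoothClosedDomain U)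
include hψ

theorem contDiffAt {t : ℝ} (ht : 0 < t) {u : Plane} (hu : u ∈ interior U) :
    ContDiffAt ℝ 2 (fun v => ψ v t) u :=
  (hψ.contDiffOn_two t ht).contDiffAt (isOpen_interior.mem_nhds hu)

theorem contDiffOn_slice {t : ℝ} (ht : 0 ≤ t) : ContDiffOn ℝ 1 (fun u => ψ u t) U :=
  hψ.contDiffOn_one.comp (contDiff_prodMk_left t).contDiffOn fun _ hu => ⟨hu, ht⟩

theorem continuousOn : ContinuousOn (fun q : Plane × ℝ => ψ q.1 q.2) (U ×ˢ Ici 0) :=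
  hψ.contDiffOn_one.continuousOn

theorem hasFDerivWithinAt {u : Plane} (hu : u ∈ U) {t : ℝ} (ht : 0 ≤ t) :
    HasFDerivWithinAt (fun p : Plane × ℝ => ψ p.1 p.2)
      (fderivWithin ℝ (fun p : Plane × ℝ => ψ p.1 p.2) (U ×ˢ Ici (0 : ℝ)) (u, t))
      (U ×ˢ Ici (0 : ℝ)) (u, t) :=
  (hψ.contDiffOn_one.differentiableOn one_ne_zero (u, t) ⟨hu, ht⟩).hasFDerivWithinAt

theorem hasDerivAt_time {u : Plane} (hu : u ∈ U) {t : ℝ} (ht : 0 < t) :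
    HasDerivAt (ψ u) (timeDeriv U ψ u t) t := by
  have h1 : HasDerivWithinAt (fun s : ℝ => (u, s)) ((0 : Plane), (1 : ℝ)) (Ici 0) t :=
    ((hasDerivAt_const t u).prodMk (hasDerivAt_id t)).hasDerivWithinAt
  have h2 := (hψ.hasFDerivWithinAt hu ht.le).comp_hasDerivWithinAt t h1 fun s hs => ⟨hu, hs⟩
  exact h2.hasDerivAt (Ici_mem_nhds ht)

/-- Replaces the second-order expression, uncontrolled near the boundary, by a function continuous
up to it. -/
theorem timeDeriv_eq {u : Plane} (hu : u ∈ interior U) {t : ℝ} (ht : 0 < t) :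
    timeDeriv U ψ u t =
      ∑ i, ∑ j, a (spaceGrad U ψ t u) i j * secondPartial i j (fun v => ψ v t) u :=
  (hψ.hasDerivAt_time (interior_subset hu) ht).unique (hψ.equation t ht u hu)

include hU

theorem continuousOn_fderivWithin : ContinuousOn
    (fderivWithin ℝ (fun p : Plane × ℝ => ψ p.1 p.2) (U ×ˢ Ici (0 : ℝ))) (U ×ˢ Ici 0) :=
  hψ.contDiffOn_one.continuousOn_fderivWithin (hU.uniqueDiffOn.prod (uniqueDiffOn_Ici 0)) le_rfl

theorem continuousOn_timeDeriv :
    ContinuousOn (fun q : Plane × ℝ => timeDeriv U ψ q.1 q.2) (U ×ˢ Ici 0) :=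
  (hψ.continuousOn_fderivWithin hU).clm_apply continuousOn_const

/-- Unique differentiability identifies the spatial gradient with the space block of the joint
derivative, which is continuous in (u, t) together. -/
theorem continuousOn_spaceGrad :
    ContinuousOn (fun q : Plane × ℝ => spaceGrad U ψ q.2 q.1) (U ×ˢ Ici 0) := by
  have h1 : ContinuousOn (fun q => (InnerProductSpace.toDual ℝ Plane).symm
      ((fderivWithin ℝ (fun p : Plane × ℝ => ψ p.1 p.2) (U ×ˢ Ici (0 : ℝ)) q).comp
        (ContinuousLinearMap.inl ℝ Plane ℝ))) (U ×ˢ Ici 0) :=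
    (InnerProductSpace.toDual ℝ Plane).symm.continuous.comp_continuousOn
      ((hψ.continuousOn_fderivWithin hU).clm_comp continuousOn_const)
  refine h1.congr ?_
  rintro ⟨u, t⟩ ⟨hu, ht⟩
  simp only [spaceGrad, gradientWithin]
  congr 1
  have h2 : HasFDerivWithinAt (fun v : Plane => (v, t)) (ContinuousLinearMap.inl ℝ Plane ℝ) U u :=
    (hasFDerivAt_prodMk_left u t).hasFDerivWithinAt
  have hmaps : MapsTo (fun v : Plane => (v, t)) U (U ×ˢ Ici (0 : ℝ)) := fun v hv => ⟨hv, ht⟩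
  exact ((hψ.hasFDerivWithinAt hu ht).comp u h2 hmaps).fderivWithin (hU.uniqueDiffOn u hu)

end IsClassicalSolution

/-! ### Comparison, drift and contraction for a general parabolic flux -/

namespace IsParabolicFlux

variable {S : Set Plane} {a : Plane → Fin 2 → Fin 2 → ℝ} {W : Plane → Plane}
  (h : IsParabolicFlux S a W) {U : Set Plane} (hU : IsSmoothClosedDomain U)
  {f₁ f₂ : Plane → ℝ} {ψ₁ ψ₂ : Plane → ℝ → ℝ}
include h hU

/-- The comparison principle. -/
theorem comparison (h₁ : IsClassicalSolution S a U f₁ ψ₁) (h₂ : IsClassicalSolution S a U f₂ ψ₂)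
    (hle : ∀ u ∈ U, f₂ u ≤ f₁ u) (heq : ∀ u ∈ frontier U, f₁ u = f₂ u) {T : ℝ} (hT : 0 ≤ T)
    {u : Plane} (hu : u ∈ U) : ψ₂ u T ≤ ψ₁ u T := by
  by_contra hcon
  have hneg : ψ₁ u T - ψ₂ u T < 0 := sub_neg.2 (not_le.1 hcon)
  -- The tilt εt makes the maximum principle strict while keeping a negative value at (u, T);
  -- dividing by T + 1 rather than T allows T = 0.
  obtain ⟨ε, hε, hεT⟩ : ∃ ε : ℝ, 0 < ε ∧ ψ₁ u T - ψ₂ u T + ε * T < 0 := by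
    refine ⟨-(ψ₁ u T - ψ₂ u T) / (2 * (T + 1)), by apply div_pos <;> linarith, ?_⟩
    have h1 : -(ψ₁ u T - ψ₂ u T) / (2 * (T + 1)) * T ≤ -(ψ₁ u T - ψ₂ u T) / 2 := by
      rw [div_mul_eq_mul_div, div_le_div_iff₀ (by linarith) two_pos]
      nlinarith
    linarith
  set m : Plane × ℝ → ℝ := fun q => ψ₁ q.1 q.2 - ψ₂ q.1 q.2 + ε * q.2 with hm
  have hsub : U ×ˢ Icc 0 T ⊆ U ×ˢ Ici (0 : ℝ) := prod_mono_right Icc_subset_Ici_self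
  have hmc : ContinuousOn m (U ×ˢ Icc 0 T) :=
    ((h₁.continuousOn.sub h₂.continuousOn).mono hsub).add (by fun_prop)
  obtain ⟨⟨x, t⟩, ⟨hx, ht⟩, hmin⟩ := (hU.isCompact.prod isCompact_Icc).exists_isMinOn
    ⟨(u, T), hu, hT, le_rfl⟩ hmc
  simp only at hx ht
  have hmt : ψ₁ x t - ψ₂ x t + ε * t < 0 :=
    (isMinOn_iff.1 hmin (u, T) ⟨hu, hT, le_rfl⟩).trans_lt hεT
  have ht0 : 0 < t := by
    refine lt_of_le_of_ne ht.1 fun h0 => ?_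
    rw [← h0, h₁.initial x hx, h₂.initial x hx] at hmt
    linarith [hle x hx]
  have hxi : x ∈ interior U := by
    by_contra hxi
    have hxf : x ∈ frontier U := ⟨subset_closure hx, hxi⟩
    rw [h₁.boundary t ht.1 x hxf, h₂.boundary t ht.1 x hxf, heq x hxf] at hmt
    nlinarith
  have hc₁ := h₁.contDiffAt ht0 hxi
  have hc₂ := h₂.contDiffAt ht0 hxi
  have hlmin : IsLocalMin (fun v => ψ₁ v t - ψ₂ v t) x := by
    filter_upwards [isOpen_interior.mem_nhds hxi] with v hv
    have := isMinOn_iff.1 hmin (v, t) ⟨interior_subset hv, ht⟩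
    simp only [hm] at this
    linarith
  -- At the minimum both equations have the same coefficients, so their difference is linear in the
  -- Hessian of ψ₁ - ψ₂.
  have hgrad : spaceGrad U ψ₁ t x = spaceGrad U ψ₂ t x := by
    have h0 := hlmin.fderiv_eq_zero
    rw [fderiv_fun_sub (hc₁.differentiableAt two_ne_zero) (hc₂.differentiableAt two_ne_zero),
      sub_eq_zero] at h0
    rw [spaceGrad_eq_gradient _ _ hxi, spaceGrad_eq_gradient _ _ hxi, gradient, gradient, h0]
  have hHess : 0 ≤ timeDeriv U ψ₁ x t - timeDeriv U ψ₂ x t := by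
    have hc := hc₁.sub hc₂
    have htr := trace_mul_nonneg (h.nonneg _ (h₁.slope_mem t ht.1 x hx))
      (p := secondPartial 0 0 (fun v => ψ₁ v t - ψ₂ v t) x)
      (q := secondPartial 0 1 (fun v => ψ₁ v t - ψ₂ v t) x)
      (r := secondPartial 1 1 (fun v => ψ₁ v t - ψ₂ v t) x) fun y z => by
        have hv := hessian_nonneg_of_isLocalMin hc hlmin !₂[y, z]
        rw [map_plane (fderiv ℝ (fderiv ℝ fun v => ψ₁ v t - ψ₂ v t) x) !₂[y, z]] at hv
        simp only [add_apply, smul_apply] at hv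
        rw [map_plane (fderiv ℝ (fderiv ℝ fun v => ψ₁ v t - ψ₂ v t) x _) !₂[y, z],
          map_plane (fderiv ℝ (fderiv ℝ fun v => ψ₁ v t - ψ₂ v t) x _) !₂[y, z]] at hv
        rw [← secondPartial_eq hc, ← secondPartial_eq hc, ← secondPartial_eq hc,
          ← secondPartial_eq hc, secondPartial_comm hc 1 0] at hv
        simp at hv
        linarith
    rw [h₁.timeDeriv_eq hxi ht0, h₂.timeDeriv_eq hxi ht0, ← hgrad]
    simp only [Fin.sum_univ_two]
    simp only [secondPartial_sub hc₁ hc₂] at htr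
    rw [secondPartial_comm hc₁ 1 0, secondPartial_comm hc₂ 1 0]
    linarith
  -- Only left difference quotients are usable, since the minimum may be attained at the final time.
  -- They give a derivative ≤ 0, against the lower bound ε.
  have hder : HasDerivWithinAt (fun s => ψ₁ x s - ψ₂ x s + ε * s)
      (timeDeriv U ψ₁ x t - timeDeriv U ψ₂ x t + ε) (Ioo 0 t) t := by
    have := ((h₁.hasDerivAt_time hx ht0).sub (h₂.hasDerivAt_time hx ht0)).add
      ((hasDerivAt_id t).const_mul ε)
    rw [mul_one] at this
    exact this.hasDerivWithinAt
  rw [hasDerivWithinAt_iff_tendsto_slope' (by simp)] at hder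
  have hne : (𝓝[Ioo 0 t] t).NeBot := by
    rw [nhdsWithin_Ioo_eq_nhdsLT ht0]; infer_instance
  have hle0 : timeDeriv U ψ₁ x t - timeDeriv U ψ₂ x t + ε ≤ 0 := by
    refine le_of_tendsto hder ?_
    filter_upwards [self_mem_nhdsWithin] with s hs
    rw [slope_def_field]
    refine div_nonpos_of_nonneg_of_nonpos ?_ (sub_nonpos.2 hs.2.le)
    have := isMinOn_iff.1 hmin (x, s) ⟨hx, hs.1.le, hs.2.le.trans ht.2⟩
    simp only [hm] at this
    linarith
  linarith

/-- The time derivative of the enclosed volume is the boundary flux. -/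
theorem hasDerivAt_volume (h₁ : IsClassicalSolution S a U f₁ ψ₁)
    (h₂ : IsClassicalSolution S a U f₂ ψ₂) {t : ℝ} (ht : 0 < t) :
    HasDerivAt (fun s => ∫ u in U, (ψ₁ u s - ψ₂ u s))
      (boundaryFlux U fun u => W (spaceGrad U ψ₁ t u) - W (spaceGrad U ψ₂ t u)) t := by
  have hslice : ContinuousOn (fun u : Plane => (u, t)) U := by fun_prop
  have hmaps : MapsTo (fun u : Plane => (u, t)) U (U ×ˢ Ici 0) := fun u hu => ⟨hu, ht.le⟩
  have hT : ContinuousOn (fun u => timeDeriv U ψ₁ u t - timeDeriv U ψ₂ u t) U :=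
    ((h₁.continuousOn_timeDeriv hU).sub (h₂.continuousOn_timeDeriv hU)).comp hslice hmaps
  have hderiv := hasDerivAt_setIntegral_param hU.isCompact
    (h₁.continuousOn.sub h₂.continuousOn)
    ((h₁.continuousOn_timeDeriv hU).sub (h₂.continuousOn_timeDeriv hU))
    (fun u hu s hs => (h₁.hasDerivAt_time hu hs).sub (h₂.hasDerivAt_time hu hs)) ht
  set X : Plane → Plane := fun u => W (spaceGrad U ψ₁ t u) - W (spaceGrad U ψ₂ t u) with hX
  have hXc : ContinuousOn X U :=
    (h.continuousOn.comp ((h₁.continuousOn_spaceGrad hU).comp hslice hmaps)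
      (h₁.slope_mem t ht.le)).sub
    (h.continuousOn.comp ((h₂.continuousOn_spaceGrad hU).comp hslice hmaps)
      (h₂.slope_mem t ht.le))
  have hint : ∀ x ∈ interior U, DifferentiableAt ℝ X x ∧
      divergence X x = timeDeriv U ψ₁ x t - timeDeriv U ψ₂ x t := fun x hx => by
    have hS₁ := h₁.slope_mem t ht.le x (interior_subset hx)
    have hS₂ := h₂.slope_mem t ht.le x (interior_subset hx)
    have e₁ := h₁.timeDeriv_eq hx ht
    have e₂ := h₂.timeDeriv_eq hx ht
    rw [spaceGrad_eq_gradient _ _ hx] at hS₁ hS₂ e₁ e₂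
    obtain ⟨d₁, v₁⟩ := h.divergence_comp_gradient (h₁.contDiffAt ht hx) hS₁
    obtain ⟨d₂, v₂⟩ := h.divergence_comp_gradient (h₂.contDiffAt ht hx) hS₂
    have hev : X =ᶠ[𝓝 x] fun y => W (gradient (fun v => ψ₁ v t) y) -
        W (gradient (fun v => ψ₂ v t) y) := by
      filter_upwards [isOpen_interior.mem_nhds hx] with y hy
      simp only [hX, spaceGrad_eq_gradient _ _ hy]
    refine ⟨(d₁.sub d₂).congr_of_eventuallyEq hev, ?_⟩
    rw [e₁, e₂, ← v₁, ← v₂]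
    simp only [divergence, hev.fderiv_eq, fderiv_fun_sub d₁ d₂]
    rw [← Finset.sum_sub_distrib]
    rfl
  -- Integrability comes from the continuous time derivatives, not from any bound on second
  -- derivatives.
  have hdivi : IntegrableOn (divergence X) (interior U) :=
    ((hT.integrableOn_compact hU.isCompact).mono_set interior_subset).congr_fun
      (fun x hx => (hint x hx).2.symm) isOpen_interior.measurableSet
  rw [← hU.integral_divergence hXc (fun x hx => (hint x hx).1) hdivi,
    ← setIntegral_congr_set hU.interior_ae_eq,
    setIntegral_congr_fun isOpen_interior.measurableSet fun x hx => (hint x hx).2,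
    setIntegral_congr_set hU.interior_ae_eq]
  exact hderiv

theorem continuousOn_boundaryFlux (h₁ : IsClassicalSolution S a U f₁ ψ₁)
    (h₂ : IsClassicalSolution S a U f₂ ψ₂) : ContinuousOn
      (fun t => boundaryFlux U fun u => W (spaceGrad U ψ₁ t u) - W (spaceGrad U ψ₂ t u))
      (Ici 0) := by
  have := hU.isFiniteMeasure_restrict_frontier
  refine continuousOn_setIntegral_param hU.isCompact_frontier (f := fun u t =>
    normalComponent U (fun u => W (spaceGrad U ψ₁ t u) - W (spaceGrad U ψ₂ t u)) u) ?_
  have hX : ContinuousOn (fun q : Plane × ℝ => W (spaceGrad U ψ₁ q.2 q.1) -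
      W (spaceGrad U ψ₂ q.2 q.1)) (U ×ˢ Ici 0) :=
    (h.continuousOn.comp (h₁.continuousOn_spaceGrad hU)
      fun q hq => h₁.slope_mem q.2 hq.2 q.1 hq.1).sub
    (h.continuousOn.comp (h₂.continuousOn_spaceGrad hU)
      fun q hq => h₂.slope_mem q.2 hq.2 q.1 hq.1)
  exact (hX.mono (prod_mono_left hU.frontier_subset)).inner
    (hU.continuousOn_exteriorNormal.comp continuousOn_fst fun q hq => hq.1)

/-- Comparison, volume drift and contraction of the mutual volume. -/
theorem volume_drift (h₁ : IsClassicalSolution S a U f₁ ψ₁)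
    (h₂ : IsClassicalSolution S a U f₂ ψ₂) (hle : ∀ u ∈ U, f₂ u ≤ f₁ u)
    (heq : ∀ u ∈ frontier U, f₁ u = f₂ u) :
    (∀ t : ℝ, 0 ≤ t → ∀ u ∈ U, ψ₂ u t ≤ ψ₁ u t) ∧
    (∀ t : ℝ, 0 ≤ t →
      IntegrableOn
        (normalComponent U fun u => W (spaceGrad U ψ₁ t u) - W (spaceGrad U ψ₂ t u))
        (frontier U) (Measure.hausdorffMeasure 1) ∧
      HasDerivWithinAt (fun s => ∫ u in U, (ψ₁ u s - ψ₂ u s))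
        (boundaryFlux U fun u => W (spaceGrad U ψ₁ t u) - W (spaceGrad U ψ₂ t u)) (Ici 0) t ∧
      (boundaryFlux U fun u => W (spaceGrad U ψ₁ t u) - W (spaceGrad U ψ₂ t u)) ≤ 0) ∧
    AntitoneOn (fun t : ℝ => ∫ u in U, |ψ₁ u t - ψ₂ u t|) (Ici 0) := by
  have hcomp : ∀ t : ℝ, 0 ≤ t → ∀ u ∈ U, ψ₂ u t ≤ ψ₁ u t := fun t ht u hu =>
    h.comparison hU h₁ h₂ hle heq ht hu
  have hflux : ∀ t : ℝ, 0 ≤ t → _ := fun t ht =>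
    h.boundaryFlux_nonpos hU (h₁.contDiffOn_slice ht) (h₂.contDiffOn_slice ht)
      (h₁.slope_mem t ht) (h₂.slope_mem t ht) (hcomp t ht) fun u hu => by
        rw [h₁.boundary t ht u hu, h₂.boundary t ht u hu, heq u hu]
  have hfin : IsFiniteMeasure ((volume : Measure Plane).restrict U) :=
    ⟨by rw [Measure.restrict_apply_univ]; exact hU.isCompact.measure_lt_top⟩
  have hvol := continuousOn_setIntegral_param (μ := volume) hU.isCompact
    (f := fun u t => ψ₁ u t - ψ₂ u t) (h₁.continuousOn.sub h₂.continuousOn)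
  have hder : ∀ t : ℝ, 0 < t → _ := fun t ht => h.hasDerivAt_volume hU h₁ h₂ ht
  refine ⟨hcomp, fun t ht => ⟨(hflux t ht).1, ?_, (hflux t ht).2⟩, ?_⟩
  -- The equation is not assumed at t = 0; there the volume is continuous and its derivative for t >
  -- 0 converges to the flux at 0, which yields the one-sided derivative.
  · rcases ht.eq_or_lt with rfl | ht
    · refine hasDerivWithinAt_Ici_of_tendsto_deriv (s := Ioi 0)
        (fun s hs => (hder s hs).differentiableAt.differentiableWithinAt)
        ((hvol 0 self_mem_Ici).mono Ioi_subset_Ici_self) self_mem_nhdsWithin ?_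
      refine Tendsto.congr' ?_ (((h.continuousOn_boundaryFlux hU h₁ h₂) 0 self_mem_Ici).mono_left
        (nhdsWithin_mono 0 Ioi_subset_Ici_self))
      filter_upwards [self_mem_nhdsWithin] with s hs using (hder s hs).deriv.symm
    · exact (hder t ht).hasDerivWithinAt
  · have hanti : AntitoneOn (fun t : ℝ => ∫ u in U, (ψ₁ u t - ψ₂ u t)) (Ici 0) := by
      refine antitoneOn_of_deriv_nonpos (convex_Ici 0) hvol ?_ ?_
      · rw [interior_Ici]
        exact fun s hs => (hder s hs).differentiableAt.differentiableWithinAt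
      · rw [interior_Ici]
        intro s hs
        rw [(hder s hs).deriv]
        exact (hflux s (le_of_lt hs)).2
    refine hanti.congr fun t ht => ?_
    refine setIntegral_congr_fun hU.isCompact.measurableSet fun u hu => ?_
    exact (abs_of_nonneg (sub_nonneg.2 (hcomp t ht u hu))).symm

end IsParabolicFlux

/-! ### Elementary derivatives -/

/-- The coordinate functional. -/
abbrev coord (i : Fin 2) : Plane →L[ℝ] ℝ := EuclideanSpace.proj i

theorem hasFDerivAt_coord (i : Fin 2) (x : Plane) : HasFDerivAt (fun y : Plane => y i) (coord i) x :=
  (coord i).hasFDerivAt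

theorem fderiv_of_components {W : Plane → Plane} {L : Fin 2 → Plane →L[ℝ] ℝ} {x : Plane}
    (h : ∀ i, HasFDerivAt (fun y => W y i) (L i) x) :
    DifferentiableAt ℝ W x ∧ ∀ v i, fderiv ℝ W x v i = L i v := by
  have hd : DifferentiableAt ℝ W x :=
    (differentiableAt_euclidean).2 fun i => (h i).differentiableAt
  refine ⟨hd, fun v i => ?_⟩
  have h1 : HasFDerivAt (fun y => W y i) ((coord i).comp (fderiv ℝ W x)) x :=
    (coord i).hasFDerivAt.comp x hd.hasFDerivAt
  rw [(h i).unique h1]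
  rfl

theorem secondPartial_eq_of_hasFDerivAt {f : Plane → ℝ} {P : Fin 2 → Plane → ℝ} {x : Plane}
    {L : Plane →L[ℝ] ℝ} (i j : Fin 2)
    (hf : ∀ᶠ y in 𝓝 x, HasFDerivAt f (P 0 y • coord 0 + P 1 y • coord 1) y)
    (hP : HasFDerivAt (P j) L x) : secondPartial i j f x = L (EuclideanSpace.single i 1) := by
  have : partialDeriv j f =ᶠ[𝓝 x] P j := by
    filter_upwards [hf] with y hy
    rw [partialDeriv, hy.fderiv]
    fin_cases j <;> simp
  rw [secondPartial, partialDeriv, (hP.congr_of_eventuallyEq this).fderiv]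

theorem intervalIntegrable_log_two_mul_sin {θ : ℝ} (h0 : 0 < θ) (hπ : θ < Real.pi) :
    IntervalIntegrable (fun t => Real.log (2 * Real.sin t)) volume 0 θ := by
  have h1 : IntervalIntegrable (fun t => Real.log 2 + Real.log (Real.sin t)) volume 0 θ :=
    intervalIntegrable_const.add intervalIntegrable_log_sin
  refine h1.congr fun t ht => ?_
  rw [uIoc_of_le h0.le] at ht
  have : 0 < Real.sin t := Real.sin_pos_of_pos_of_lt_pi ht.1 (ht.2.trans_lt hπ)
  exact (Real.log_mul two_ne_zero this.ne').symm

theorem sin_pi_mul_pos {x : ℝ} (h0 : 0 < x) (h1 : x < 1) : 0 < Real.sin (Real.pi * x) :=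
  Real.sin_pos_of_pos_of_lt_pi (mul_pos Real.pi_pos h0) (by nlinarith [Real.pi_pos])

/-- The summand of the surface tension. -/
def tensionTerm (x : ℝ) : ℝ := 1 / Real.pi * lobLambda (Real.pi * x)

/-- The derivative of `tensionTerm`. -/
def tensionTerm' (x : ℝ) : ℝ := Real.log (2 * Real.sin (Real.pi * x))

/-- The second derivative of `tensionTerm`. -/
def tensionTerm'' (x : ℝ) : ℝ := Real.pi * (Real.cos (Real.pi * x) / Real.sin (Real.pi * x))

theorem hasDerivAt_pi_mul (x : ℝ) : HasDerivAt (fun y => Real.pi * y) Real.pi x := by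
  simpa using (hasDerivAt_id x).const_mul Real.pi

theorem hasDerivAt_sin_pi (x : ℝ) :
    HasDerivAt (fun y => Real.sin (Real.pi * y)) (Real.pi * Real.cos (Real.pi * x)) x := by
  simpa [mul_comm] using (hasDerivAt_pi_mul x).sin

theorem hasDerivAt_tensionTerm {x : ℝ} (h0 : 0 < x) (h1 : x < 1) :
    HasDerivAt tensionTerm (tensionTerm' x) x := by
  have hs := sin_pi_mul_pos h0 h1
  have hlt : Real.pi * x < Real.pi := by nlinarith [Real.pi_pos]
  have hc : ContinuousAt (fun t => Real.log (2 * Real.sin t)) (Real.pi * x) :=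
    ContinuousAt.log (by fun_prop) (by positivity)
  have hL : HasDerivAt lobLambda (Real.log (2 * Real.sin (Real.pi * x))) (Real.pi * x) := by
    refine intervalIntegral.integral_hasDerivAt_right
      (intervalIntegrable_log_two_mul_sin (mul_pos Real.pi_pos h0) hlt) ?_ hc
    exact (Measurable.stronglyMeasurable (by fun_prop)).stronglyMeasurableAtFilter
  have := (hL.comp x (hasDerivAt_pi_mul x)).const_mul (1 / Real.pi)
  refine this.congr_deriv ?_
  rw [tensionTerm']
  field_simp

theorem hasDerivAt_tensionTerm' {x : ℝ} (h0 : 0 < x) (h1 : x < 1) :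
    HasDerivAt tensionTerm' (tensionTerm'' x) x := by
  have hs := sin_pi_mul_pos h0 h1
  have := ((hasDerivAt_sin_pi x).const_mul 2).log (by positivity)
  refine this.congr_deriv ?_
  rw [tensionTerm'']
  field_simp

theorem surfaceTension_eq (ρ : Plane) : surfaceTension ρ =
    tensionTerm (ρ 0) + tensionTerm (ρ 1) + tensionTerm (1 - ρ 0 - ρ 1) := by
  simp only [surfaceTension, tensionTerm]; ring

/-- The trigonometry of a triangle with angles `π x, π y, π (1 - x - y)`. -/
theorem sin_cos_third (x y : ℝ) :
    Real.sin (Real.pi * (1 - x - y)) = Real.sin (Real.pi * x) * Real.cos (Real.pi * y) +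
      Real.cos (Real.pi * x) * Real.sin (Real.pi * y) ∧
    Real.cos (Real.pi * (1 - x - y)) = Real.sin (Real.pi * x) * Real.sin (Real.pi * y) -
      Real.cos (Real.pi * x) * Real.cos (Real.pi * y) := by
  have : Real.pi * (1 - x - y) = Real.pi - (Real.pi * x + Real.pi * y) := by ring
  rw [this, Real.sin_pi_sub, Real.cos_pi_sub, Real.sin_add, Real.cos_add]
  exact ⟨rfl, by ring⟩

/-- The coefficients are π times cotangents of the angles of a triangle, one of which may be
negative. Over the product of the three positive sines, completing the square in u leaves a sum of
two squares. -/
theorem tensionTerm''_form_nonneg {x y : ℝ} (hx : 0 < x) (hy : 0 < y) (hxy : x + y < 1) (u v : ℝ) :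
    0 ≤ tensionTerm'' x * u ^ 2 + tensionTerm'' y * v ^ 2 +
      tensionTerm'' (1 - x - y) * (u + v) ^ 2 := by
  have ha := sin_pi_mul_pos hx (by linarith)
  have hb := sin_pi_mul_pos hy (by linarith)
  have hc := sin_pi_mul_pos (x := 1 - x - y) (by linarith) (by linarith)
  obtain ⟨h1, h2⟩ := sin_cos_third x y
  have ea := Real.sin_sq_add_cos_sq (Real.pi * x)
  simp only [tensionTerm'']
  rw [h1] at hc
  rw [h1, h2]
  set sa := Real.sin (Real.pi * x)
  set sb := Real.sin (Real.pi * y)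
  set ca := Real.cos (Real.pi * x)
  set cb := Real.cos (Real.pi * y)
  have key : Real.pi * (ca / sa) * u ^ 2 + Real.pi * (cb / sb) * v ^ 2 +
      Real.pi * ((sa * sb - ca * cb) / (sa * cb + ca * sb)) * (u + v) ^ 2 =
      Real.pi * ((sb * u + sa * (sa * sb - ca * cb) * v) ^ 2 +
        (sa * (sa * cb + ca * sb) * v) ^ 2) / (sa * sb * (sa * cb + ca * sb)) := by
    have e : ca * sb * (sa * cb + ca * sb) * u ^ 2 + cb * sa * (sa * cb + ca * sb) * v ^ 2 +
        (sa * sb - ca * cb) * sa * sb * (u + v) ^ 2 =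
        (sb * u + sa * (sa * sb - ca * cb) * v) ^ 2 + (sa * (sa * cb + ca * sb) * v) ^ 2 := by
      linear_combination (sb ^ 2 * u ^ 2 - sa ^ 2 * v ^ 2 * (sb ^ 2 + cb ^ 2)) * ea
    rw [← e]
    field_simp
  rw [key]
  positivity

/-! ### The height function equation -/

theorem isOpen_triangle : IsOpen triangle := by
  have h0 : Continuous fun ρ : Plane => ρ 0 := (coord 0).continuous
  have h1 : Continuous fun ρ : Plane => ρ 1 := (coord 1).continuous
  exact (isOpen_lt continuous_const h0).inter
    ((isOpen_lt continuous_const h1).inter (isOpen_lt (h0.add h1) continuous_const))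

theorem convex_triangle : Convex ℝ triangle := by
  rintro x ⟨hx0, hx1, hx2⟩ y ⟨hy0, hy1, hy2⟩ a b ha hb hab
  simp only [triangle, mem_ofPred_eq, PiLp.add_apply, PiLp.smul_apply, smul_eq_mul]
  rcases ha.eq_or_lt with rfl | ha
  · rw [zero_add] at hab; subst hab; simpa using ⟨hy0, hy1, hy2⟩
  · refine ⟨by nlinarith [mul_pos ha hx0, mul_nonneg hb hy0.le],
      by nlinarith [mul_pos ha hx1, mul_nonneg hb hy1.le], ?_⟩
    nlinarith [mul_lt_mul_of_pos_left hx2 ha, mul_le_mul_of_nonneg_left hy2.le hb]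

/-- The slope of the third lozenge type. -/
theorem hasFDerivAt_third (ρ : Plane) :
    HasFDerivAt (fun y : Plane => 1 - y 0 - y 1) (-coord 0 - coord 1) ρ := by
  exact ((hasFDerivAt_coord 0 ρ).const_sub 1).sub (hasFDerivAt_coord 1 ρ)

theorem secondPartial_surfaceTension {ρ : Plane} (hρ : ρ ∈ triangle) :
    secondPartial 0 0 surfaceTension ρ =
      tensionTerm'' (ρ 0) + tensionTerm'' (1 - ρ 0 - ρ 1) ∧
    secondPartial 0 1 surfaceTension ρ = tensionTerm'' (1 - ρ 0 - ρ 1) ∧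
    secondPartial 1 0 surfaceTension ρ = tensionTerm'' (1 - ρ 0 - ρ 1) ∧
    secondPartial 1 1 surfaceTension ρ =
      tensionTerm'' (ρ 1) + tensionTerm'' (1 - ρ 0 - ρ 1) := by
  let P : Fin 2 → Plane → ℝ := fun j y => tensionTerm' (y j) - tensionTerm' (1 - y 0 - y 1)
  have hf : ∀ᶠ y in 𝓝 ρ, HasFDerivAt surfaceTension (P 0 y • coord 0 + P 1 y • coord 1) y := by
    filter_upwards [isOpen_triangle.mem_nhds hρ] with y hy
    obtain ⟨h0, h1, h2⟩ := hy
    have e0 := (hasDerivAt_tensionTerm h0 (by linarith)).comp_hasFDerivAt y (hasFDerivAt_coord 0 y)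
    have e1 := (hasDerivAt_tensionTerm h1 (by linarith)).comp_hasFDerivAt y (hasFDerivAt_coord 1 y)
    have e2 := (hasDerivAt_tensionTerm (x := 1 - y 0 - y 1) (by linarith)
      (by linarith)).comp_hasFDerivAt y (hasFDerivAt_third y)
    have := ((e0.add e1).add e2).congr_of_eventuallyEq
      (Eventually.of_forall fun z => surfaceTension_eq z)
    refine this.congr_fderiv ?_
    ext v
    simp [P]
    ring
  obtain ⟨h0, h1, h2⟩ := hρ
  have e0 := (hasDerivAt_tensionTerm' h0 (by linarith)).comp_hasFDerivAt ρ (hasFDerivAt_coord 0 ρ)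
  have e1 := (hasDerivAt_tensionTerm' h1 (by linarith)).comp_hasFDerivAt ρ (hasFDerivAt_coord 1 ρ)
  have e2 := (hasDerivAt_tensionTerm' (x := 1 - ρ 0 - ρ 1) (by linarith)
      (by linarith)).comp_hasFDerivAt ρ (hasFDerivAt_third ρ)
  have hP0 : HasFDerivAt (P 0) (tensionTerm'' (ρ 0) • coord 0 -
      tensionTerm'' (1 - ρ 0 - ρ 1) • (-coord 0 - coord 1)) ρ :=
    e0.sub e2
  have hP1 : HasFDerivAt (P 1) (tensionTerm'' (ρ 1) • coord 1 -
      tensionTerm'' (1 - ρ 0 - ρ 1) • (-coord 0 - coord 1)) ρ :=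
    e1.sub e2
  rw [secondPartial_eq_of_hasFDerivAt 0 0 hf hP0, secondPartial_eq_of_hasFDerivAt 0 1 hf hP1,
    secondPartial_eq_of_hasFDerivAt 1 0 hf hP0, secondPartial_eq_of_hasFDerivAt 1 1 hf hP1]
  simp

/-- Free indices let one computation serve both components of `fluxW`, which differ by exchanging
coordinates. -/
theorem hasFDerivAt_fluxW₁ {ρ : Plane} (i j : Fin 2)
    (hs : Real.sin (Real.pi * (ρ i + ρ j)) ≠ 0) :
    HasFDerivAt (fun y : Plane => fluxW₁ (y i) (y j))
      ((1 / 2 * Real.sin (Real.pi * ρ j) ^ 2 / Real.sin (Real.pi * (ρ i + ρ j)) ^ 2) •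
          (coord i + coord j) +
        (-(Real.cos (Real.pi * (ρ i + ρ j)) / Real.sin (Real.pi * (ρ i + ρ j))) *
          (Real.sin (Real.pi * ρ j) * Real.cos (Real.pi * ρ j)) - 1 / 4 +
          1 / 2 * Real.cos (2 * Real.pi * ρ j)) • coord j) ρ := by
  have hsum : HasFDerivAt (fun y : Plane => y i + y j) (coord i + coord j) ρ :=
    (hasFDerivAt_coord i ρ).add (hasFDerivAt_coord j ρ)
  have hcos : HasDerivAt (fun s => Real.cos (Real.pi * s))
      (-(Real.pi * Real.sin (Real.pi * (ρ i + ρ j)))) (ρ i + ρ j) := by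
    simpa [mul_comm] using (hasDerivAt_pi_mul (ρ i + ρ j)).cos
  have hcot : HasDerivAt (fun s => Real.cot (Real.pi * s))
      (-Real.pi / Real.sin (Real.pi * (ρ i + ρ j)) ^ 2) (ρ i + ρ j) := by
    have := hcos.div (hasDerivAt_sin_pi (ρ i + ρ j)) hs
    simp only [Real.cot_eq_cos_div_sin]
    refine this.congr_deriv ?_
    congr 1
    linear_combination (-Real.pi) * Real.sin_sq_add_cos_sq (Real.pi * (ρ i + ρ j))
  have hK := hcot.comp_hasFDerivAt ρ hsum
  have hS := ((hasDerivAt_sin_pi (ρ j)).pow 2).comp_hasFDerivAt ρ (hasFDerivAt_coord j ρ)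
  have hsin2 : HasDerivAt (fun s => Real.sin (2 * Real.pi * s))
      (2 * Real.pi * Real.cos (2 * Real.pi * ρ j)) (ρ j) := by
    simpa [mul_comm] using ((hasDerivAt_id (ρ j)).const_mul (2 * Real.pi)).sin
  have hT := hsin2.comp_hasFDerivAt ρ (hasFDerivAt_coord j ρ)
  have hall := (((hK.const_mul (-(1 / (2 * Real.pi)))).mul hS).sub
    ((hasFDerivAt_coord j ρ).const_mul (1 / 4))).add (hT.const_mul (1 / (4 * Real.pi)))
  refine (hall.congr_of_eventuallyEq (Eventually.of_forall fun y => ?_)).congr_fderiv ?_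
  · simp [fluxW₁]
    ring
  have hπ := Real.pi_ne_zero
  ext v
  simp [Real.cot_eq_cos_div_sin]
  field_simp
  ring

/-- For angles α, β, γ with sum π one has cot α + cot γ = sin β / (sin α sin γ); the mobility
cancels the remaining sine and the factor π. -/
theorem mobility_mul_tensionTerm'' {ρ : Plane} (hρ : ρ ∈ triangle) :
    mobility ρ * (tensionTerm'' (ρ 0) + tensionTerm'' (1 - ρ 0 - ρ 1)) =
      1 / 2 * Real.sin (Real.pi * ρ 1) ^ 2 / Real.sin (Real.pi * (1 - ρ 0 - ρ 1)) ^ 2 ∧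
    mobility ρ * (tensionTerm'' (ρ 1) + tensionTerm'' (1 - ρ 0 - ρ 1)) =
      1 / 2 * Real.sin (Real.pi * ρ 0) ^ 2 / Real.sin (Real.pi * (1 - ρ 0 - ρ 1)) ^ 2 ∧
    mobility ρ * tensionTerm'' (1 - ρ 0 - ρ 1) =
      1 / 2 * (Real.sin (Real.pi * ρ 0) * Real.sin (Real.pi * ρ 1) *
        Real.cos (Real.pi * (1 - ρ 0 - ρ 1))) / Real.sin (Real.pi * (1 - ρ 0 - ρ 1)) ^ 2 := by
  obtain ⟨h0, h1, h2⟩ := hρ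
  have ha := (sin_pi_mul_pos h0 (by linarith)).ne'
  have hb := (sin_pi_mul_pos h1 (by linarith)).ne'
  have hc := (sin_pi_mul_pos (x := 1 - ρ 0 - ρ 1) (by linarith) (by linarith)).ne'
  obtain ⟨e1, e2⟩ := sin_cos_third (ρ 0) (ρ 1)
  have ea := Real.sin_sq_add_cos_sq (Real.pi * ρ 0)
  have eb := Real.sin_sq_add_cos_sq (Real.pi * ρ 1)
  have hπ := Real.pi_ne_zero
  simp only [mobility, interfaceSpeed, tensionTerm'']
  refine ⟨?_, ?_, ?_⟩
  · field_simp
    rw [e1, e2]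
    linear_combination Real.sin (Real.pi * ρ 1) * ea
  · field_simp
    rw [e1, e2]
    linear_combination Real.sin (Real.pi * ρ 0) * eb
  · field_simp

/-- The diagonal derivatives of `fluxW` match the coefficients one by one, the two mixed ones only
through their sum. -/
theorem isParabolicFlux_fluxW : IsParabolicFlux triangle
    (fun ρ i j => mobility ρ * secondPartial i j surfaceTension ρ) fluxW := by
  have hsin : ∀ ρ ∈ triangle, Real.sin (Real.pi * (ρ 0 + ρ 1)) ≠ 0 := fun ρ hρ =>
    (sin_pi_mul_pos (by linarith [hρ.1, hρ.2.1]) hρ.2.2).ne'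
  let L : Plane → Fin 2 → Plane →L[ℝ] ℝ := fun ρ => ![
    (1 / 2 * Real.sin (Real.pi * ρ 1) ^ 2 / Real.sin (Real.pi * (ρ 0 + ρ 1)) ^ 2) •
      (coord 0 + coord 1) +
    (-(Real.cos (Real.pi * (ρ 0 + ρ 1)) / Real.sin (Real.pi * (ρ 0 + ρ 1))) *
      (Real.sin (Real.pi * ρ 1) * Real.cos (Real.pi * ρ 1)) - 1 / 4 +
      1 / 2 * Real.cos (2 * Real.pi * ρ 1)) • coord 1,
    (1 / 2 * Real.sin (Real.pi * ρ 0) ^ 2 / Real.sin (Real.pi * (ρ 1 + ρ 0)) ^ 2) •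
      (coord 1 + coord 0) +
    (-(Real.cos (Real.pi * (ρ 1 + ρ 0)) / Real.sin (Real.pi * (ρ 1 + ρ 0))) *
      (Real.sin (Real.pi * ρ 0) * Real.cos (Real.pi * ρ 0)) - 1 / 4 +
      1 / 2 * Real.cos (2 * Real.pi * ρ 0)) • coord 0]
  have hcomp : ∀ ρ ∈ triangle, ∀ i, HasFDerivAt (fun y => fluxW y i) (L ρ i) ρ := fun ρ hρ i => by
    fin_cases i
    · exact hasFDerivAt_fluxW₁ 0 1 (hsin ρ hρ)
    · exact hasFDerivAt_fluxW₁ 1 0 (by rw [add_comm]; exact hsin ρ hρ)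
  have hpos : ∀ ρ ∈ triangle, 0 < Real.sin (Real.pi * ρ 0) ∧ 0 < Real.sin (Real.pi * ρ 1) ∧
      0 < Real.sin (Real.pi * (1 - ρ 0 - ρ 1)) := fun ρ ⟨h0, h1, h2⟩ =>
    ⟨sin_pi_mul_pos h0 (by linarith), sin_pi_mul_pos h1 (by linarith),
      sin_pi_mul_pos (by linarith) (by linarith)⟩
  have hthird : ∀ ρ : Plane, Real.sin (Real.pi * (1 - ρ 0 - ρ 1)) =
      Real.sin (Real.pi * (ρ 0 + ρ 1)) := fun ρ => by
    rw [(sin_cos_third _ _).1, mul_add, Real.sin_add]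
  refine ⟨convex_triangle, fun ρ hρ => (fderiv_of_components (hcomp ρ hρ)).1, fun ρ hρ => ?_,
    fun ρ hρ => ?_, fun ρ hρ => ?_, fun ρ hρ x y => ?_⟩
  · rw [(fderiv_of_components (hcomp ρ hρ)).2, (secondPartial_surfaceTension hρ).1,
      (mobility_mul_tensionTerm'' hρ).1, hthird]
    simp [L]
  · rw [(fderiv_of_components (hcomp ρ hρ)).2, (secondPartial_surfaceTension hρ).2.2.2,
      (mobility_mul_tensionTerm'' hρ).2.1, hthird]
    simp [L, add_comm]
  · obtain ⟨-, h01, h10, -⟩ := secondPartial_surfaceTension hρ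
    have hs := hsin ρ hρ
    rw [(fderiv_of_components (hcomp ρ hρ)).2, (fderiv_of_components (hcomp ρ hρ)).2, h01, h10,
      (mobility_mul_tensionTerm'' hρ).2.2, hthird, (sin_cos_third _ _).2]
    simp [L, add_comm (ρ 1) (ρ 0), mul_assoc, Real.cos_two_mul]
    have ea := Real.sin_sq_add_cos_sq (Real.pi * ρ 0)
    have eb := Real.sin_sq_add_cos_sq (Real.pi * ρ 1)
    field_simp
    have eS := Real.sin_add (Real.pi * ρ 0) (Real.pi * ρ 1)
    have eC := Real.cos_add (Real.pi * ρ 0) (Real.pi * ρ 1)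
    rw [← mul_add] at eS eC
    rw [eS, eC]
    set sa := Real.sin (Real.pi * ρ 0)
    set sb := Real.sin (Real.pi * ρ 1)
    set ca := Real.cos (Real.pi * ρ 0)
    set cb := Real.cos (Real.pi * ρ 1)
    -- With α, β the two angles, these are the product formulas sin(α+β)cos(α-β) and
    -- cos(α+β)cos(α-β), followed by an expansion of sin²(α+β).
    have h1 : sa * ca + sb * cb = (sa * cb + ca * sb) * (ca * cb + sa * sb) := by
      linear_combination (-(sa * ca)) * eb - sb * cb * ea
    have h2 : ca ^ 2 + cb ^ 2 - 1 = (ca * cb - sa * sb) * (ca * cb + sa * sb) := by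
      linear_combination sb ^ 2 * ea + (1 - ca ^ 2) * eb
    have h3 : (sa * cb + ca * sb) ^ 2 = sa ^ 2 + sb ^ 2 + 2 * sa * sb * (ca * cb - sa * sb) := by
      linear_combination sa ^ 2 * eb + sb ^ 2 * ea
    linear_combination (-4) * h3 - 8 * (ca * cb - sa * sb) * (sa * cb + ca * sb) * h1 +
      8 * (sa * cb + ca * sb) ^ 2 * h2
  · obtain ⟨ha, hb, hc⟩ := hpos ρ hρ
    have hm : 0 < mobility ρ := by
      have := Real.pi_pos
      simp only [mobility, interfaceSpeed]
      positivity
    obtain ⟨h00, h01, h10, h11⟩ := secondPartial_surfaceTension hρ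
    have := mul_nonneg hm.le (tensionTerm''_form_nonneg hρ.1 hρ.2.1 hρ.2.2 x y)
    simp only [h00, h01, h10, h11]
    linarith

/-! ### The level set equation -/

theorem isOpen_levelSlopes : IsOpen levelSlopes := by
  have h0 : Continuous fun ρ : Plane => ρ 0 := (coord 0).continuous
  have h1 : Continuous fun ρ : Plane => ρ 1 := (coord 1).continuous
  exact (isOpen_lt continuous_const h0).inter
    ((isOpen_lt h0 continuous_const).inter (isOpen_lt continuous_const h1))

theorem convex_levelSlopes : Convex ℝ levelSlopes := by
  rintro x ⟨hx0, hx1, hx2⟩ y ⟨hy0, hy1, hy2⟩ a b ha hb hab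
  simp only [levelSlopes, mem_ofPred_eq, PiLp.add_apply, PiLp.smul_apply, smul_eq_mul]
  rcases ha.eq_or_lt with rfl | ha
  · rw [zero_add] at hab; subst hab; simpa using ⟨hy0, hy1, hy2⟩
  · refine ⟨?_, ?_, by nlinarith [mul_pos ha hx2, mul_nonneg hb hy2.le]⟩
    · nlinarith [mul_lt_mul_of_pos_left hx0 ha, mul_le_mul_of_nonneg_left hy0.le hb]
    · nlinarith [mul_lt_mul_of_pos_left hx1 ha, mul_le_mul_of_nonneg_left hy1.le hb]

theorem slopeOfLevel_mem_triangle {s : Plane} (hs : s ∈ levelSlopes) :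
    slopeOfLevel s ∈ triangle := by
  obtain ⟨h0, h1, h2⟩ := hs
  have h3 : 0 < 2 + s 1 := by linarith
  refine ⟨div_pos (by linarith) h3, div_pos (by linarith) h3, ?_⟩
  change (1 - s 0) / (2 + s 1) + (1 + s 0) / (2 + s 1) < 1
  rw [← add_div, div_lt_one h3]
  linarith

theorem hasFDerivAt_slopeOfLevel_zero {s : Plane} (hs : 2 + s 1 ≠ 0) :
    HasFDerivAt (fun y => slopeOfLevel y 0)
      (-(2 + s 1)⁻¹ • (coord 0 + slopeOfLevel s 0 • coord 1)) s := by
  have hn := (hasFDerivAt_coord 0 s).const_sub 1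
  have hd := (hasDerivAt_inv hs).comp_hasFDerivAt s ((hasFDerivAt_coord 1 s).const_add 2)
  refine (hn.mul hd).congr_fderiv ?_
  ext v
  simp [slopeOfLevel]
  field_simp
  ring

theorem hasFDerivAt_slopeOfLevel_one {s : Plane} (hs : 2 + s 1 ≠ 0) :
    HasFDerivAt (fun y => slopeOfLevel y 1)
      ((2 + s 1)⁻¹ • (coord 0 - slopeOfLevel s 1 • coord 1)) s := by
  have hn := (hasFDerivAt_coord 0 s).const_add 1
  have hd := (hasDerivAt_inv hs).comp_hasFDerivAt s ((hasFDerivAt_coord 1 s).const_add 2)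
  refine (hn.mul hd).congr_fderiv ?_
  ext v
  simp [slopeOfLevel]
  field_simp
  ring

/-- The two slopes sum to 2/(2 + s₂), so the third does not vary with s₁. -/
theorem hasFDerivAt_slopeOfLevel_third {s : Plane} (hs : 2 + s 1 ≠ 0) :
    HasFDerivAt (fun y => 1 - slopeOfLevel y 0 - slopeOfLevel y 1)
      (((2 + s 1)⁻¹ * (slopeOfLevel s 0 + slopeOfLevel s 1)) • coord 1) s := by
  refine (((hasFDerivAt_slopeOfLevel_zero hs).const_sub 1).sub
    (hasFDerivAt_slopeOfLevel_one hs)).congr_fderiv ?_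
  ext v
  simp
  ring

theorem secondPartial_levelTension {s : Plane} (hs : s ∈ levelSlopes) :
    secondPartial 0 0 levelTension s = (2 + s 1)⁻¹ / 2 *
      (tensionTerm'' (slopeOfLevel s 0) + tensionTerm'' (slopeOfLevel s 1)) ∧
    secondPartial 0 1 levelTension s = (2 + s 1)⁻¹ / 2 *
      (tensionTerm'' (slopeOfLevel s 0) * slopeOfLevel s 0 -
        tensionTerm'' (slopeOfLevel s 1) * slopeOfLevel s 1) ∧
    secondPartial 1 0 levelTension s = (2 + s 1)⁻¹ / 2 *
      (tensionTerm'' (slopeOfLevel s 0) * slopeOfLevel s 0 -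
        tensionTerm'' (slopeOfLevel s 1) * slopeOfLevel s 1) ∧
    secondPartial 1 1 levelTension s = (2 + s 1)⁻¹ / 2 *
      (tensionTerm'' (slopeOfLevel s 0) * slopeOfLevel s 0 ^ 2 +
        tensionTerm'' (slopeOfLevel s 1) * slopeOfLevel s 1 ^ 2 +
        tensionTerm'' (1 - slopeOfLevel s 0 - slopeOfLevel s 1) *
          (slopeOfLevel s 0 + slopeOfLevel s 1) ^ 2) := by
  let r : Fin 2 → Plane → ℝ := fun i y => slopeOfLevel y i
  let q : Plane → ℝ := fun y => 1 - slopeOfLevel y 0 - slopeOfLevel y 1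
  -- The candidate gradient of `levelTension`. The prefactor 1 + s₂/2 times the factor 1/(2 + s₂)
  -- from the chain rule is 1/2, so it depends on s only through ρ(s).
  let P : Fin 2 → Plane → ℝ := ![
    fun y => 1 / 2 * (tensionTerm' (r 1 y) - tensionTerm' (r 0 y)),
    fun y => 1 / 2 * (tensionTerm (r 0 y) + tensionTerm (r 1 y) + tensionTerm (q y) -
      (r 0 y * tensionTerm' (r 0 y) + r 1 y * tensionTerm' (r 1 y)) +
      (r 0 y + r 1 y) * tensionTerm' (q y))]
  have hpos : ∀ y ∈ levelSlopes, (0 < r 0 y ∧ r 0 y < 1) ∧ (0 < r 1 y ∧ r 1 y < 1) ∧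
      (0 < q y ∧ q y < 1) ∧ 0 < 2 + y 1 := fun y hy => by
    obtain ⟨h0, h1, h2⟩ := slopeOfLevel_mem_triangle hy
    refine ⟨⟨h0, ?_⟩, ⟨h1, ?_⟩, ⟨?_, ?_⟩, by linarith [hy.2.2]⟩ <;> simp only [r, q] <;> linarith
  have hr0 : ∀ y ∈ levelSlopes, _ := fun y hy =>
    hasFDerivAt_slopeOfLevel_zero (s := y) (hpos y hy).2.2.2.ne'
  have hr1 : ∀ y ∈ levelSlopes, _ := fun y hy =>
    hasFDerivAt_slopeOfLevel_one (s := y) (hpos y hy).2.2.2.ne'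
  have hq : ∀ y ∈ levelSlopes, _ := fun y hy =>
    hasFDerivAt_slopeOfLevel_third (s := y) (hpos y hy).2.2.2.ne'
  have hT : ∀ y ∈ levelSlopes, _ := fun y hy =>
    (((hasDerivAt_tensionTerm (hpos y hy).1.1 (hpos y hy).1.2).comp_hasFDerivAt y (hr0 y hy)).add
      ((hasDerivAt_tensionTerm (hpos y hy).2.1.1 (hpos y hy).2.1.2).comp_hasFDerivAt y
        (hr1 y hy))).add
      ((hasDerivAt_tensionTerm (hpos y hy).2.2.1.1 (hpos y hy).2.2.1.2).comp_hasFDerivAt y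
        (hq y hy))
  have hf : ∀ᶠ y in 𝓝 s, HasFDerivAt levelTension (P 0 y • coord 0 + P 1 y • coord 1) y := by
    filter_upwards [isOpen_levelSlopes.mem_nhds hs] with y hy
    have hk := ((hasFDerivAt_coord 1 y).const_mul (1 / 2)).const_add 1
    have := (hk.mul (hT y hy)).congr_of_eventuallyEq
      (f₁ := levelTension) (Eventually.of_forall fun z => by
        simp only [levelTension, surfaceTension_eq, r, q, Pi.mul_apply, Pi.add_apply,
          Function.comp_apply]
        ring)
    refine this.congr_fderiv ?_
    have hy2 := (hpos y hy).2.2.2.ne'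
    ext v
    simp [P, r, q]
    field_simp
    ring
  have e0 := (hasDerivAt_tensionTerm' (hpos s hs).1.1 (hpos s hs).1.2).comp_hasFDerivAt s
    (hr0 s hs)
  have e1 := (hasDerivAt_tensionTerm' (hpos s hs).2.1.1 (hpos s hs).2.1.2).comp_hasFDerivAt s
    (hr1 s hs)
  have e2 := (hasDerivAt_tensionTerm' (hpos s hs).2.2.1.1 (hpos s hs).2.2.1.2).comp_hasFDerivAt s
    (hq s hs)
  have hP0 := (e1.sub e0).const_mul (1 / 2)
  have hP1 := ((((hT s hs).sub (((hr0 s hs).mul e0).add ((hr1 s hs).mul e1)))).add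
    (((hr0 s hs).add (hr1 s hs)).mul e2)).const_mul (1 / 2)
  have hs2 := (hpos s hs).2.2.2.ne'
  rw [secondPartial_eq_of_hasFDerivAt (P := P) 0 0 hf hP0,
    secondPartial_eq_of_hasFDerivAt (P := P) 0 1 hf hP1,
    secondPartial_eq_of_hasFDerivAt (P := P) 1 0 hf hP0,
    secondPartial_eq_of_hasFDerivAt (P := P) 1 1 hf hP1]
  refine ⟨?_, ?_, ?_, ?_⟩ <;> simp [r, q] <;> field_simp <;> ring

/-- Here `v₀`, `v₁` are the partial derivatives of V. Since (1 + s₂/2)(ρ₁ + ρ₂) = 1, G is (1 +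
s₂/2)ρ₁ρ₂ - V(ρ(s)), which is why V itself is absent from the derivative. -/
theorem hasFDerivAt_levelG {s : Plane} (hs : s ∈ levelSlopes) {a b v₀ v₁ : ℝ}
    (ha : slopeOfLevel s 0 = a) (hb : slopeOfLevel s 1 = b)
    (hv₀ : v₀ = Real.cos (Real.pi * a) * Real.sin (Real.pi * b) / Real.sin (Real.pi * (1 - a - b)) +
      Real.sin (Real.pi * a) * Real.sin (Real.pi * b) * Real.cos (Real.pi * (1 - a - b)) /
        Real.sin (Real.pi * (1 - a - b)) ^ 2)
    (hv₁ : v₁ = Real.sin (Real.pi * a) * Real.cos (Real.pi * b) / Real.sin (Real.pi * (1 - a - b)) +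
      Real.sin (Real.pi * a) * Real.sin (Real.pi * b) * Real.cos (Real.pi * (1 - a - b)) /
        Real.sin (Real.pi * (1 - a - b)) ^ 2) :
    HasFDerivAt levelG ((1 / 2 * ((a - b) + (a + b) * (v₀ - v₁))) • coord 0 +
      (1 / 2 * (-(a * b) + (a + b) * (a * v₀ + b * v₁))) • coord 1) s := by
  obtain ⟨h0, h1, h2⟩ := slopeOfLevel_mem_triangle hs
  have hs2 : 2 + s 1 ≠ 0 := by linarith [hs.2.2]
  have hr0 := hasFDerivAt_slopeOfLevel_zero hs2
  have hr1 := hasFDerivAt_slopeOfLevel_one hs2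
  have hq := hasFDerivAt_slopeOfLevel_third hs2
  have hsin := (sin_pi_mul_pos (x := 1 - slopeOfLevel s 0 - slopeOfLevel s 1)
    (by linarith) (by linarith)).ne'
  have f0 := (hasDerivAt_sin_pi _).comp_hasFDerivAt s hr0
  have f1 := (hasDerivAt_sin_pi _).comp_hasFDerivAt s hr1
  have f2 := (hasDerivAt_inv hsin).comp_hasFDerivAt s
    ((hasDerivAt_sin_pi _).comp_hasFDerivAt s hq)
  have hVd := ((f0.mul f1).mul f2).const_mul (1 / Real.pi)
  have hk := ((hasFDerivAt_coord 1 s).const_mul (1 / 2)).const_add 1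
  have hall := hk.mul ((hr0.mul hr1).sub ((hr0.add hr1).mul hVd))
  refine (hall.congr_of_eventuallyEq (Eventually.of_forall fun y => ?_)).congr_fderiv ?_
  · simp [levelG, interfaceSpeed, div_eq_mul_inv]
    left; ring
  · have hπ := Real.pi_ne_zero
    ext v
    rw [ha, hb] at hsin
    subst hv₀ hv₁
    simp [ha, hb]
    field_simp
    ring

/-- The sum of cotangents cot α + cot β is sin(α+β)/(sin α sin β) > 0. This makes the mobility
positive and its defining division genuine. -/
theorem secondPartial_levelTension_pos {s : Plane} (hs : s ∈ levelSlopes) :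
    0 < secondPartial 0 0 levelTension s := by
  obtain ⟨h0, h1, h2⟩ := slopeOfLevel_mem_triangle hs
  have hs2 : 0 < 2 + s 1 := by linarith [hs.2.2]
  have ha := sin_pi_mul_pos h0 (by linarith)
  have hb := sin_pi_mul_pos h1 (by linarith)
  have hc := sin_pi_mul_pos (x := 1 - slopeOfLevel s 0 - slopeOfLevel s 1)
    (by linarith) (by linarith)
  rw [(sin_cos_third _ _).1] at hc
  rw [(secondPartial_levelTension hs).1]
  have : tensionTerm'' (slopeOfLevel s 0) + tensionTerm'' (slopeOfLevel s 1) =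
      Real.pi * (Real.sin (Real.pi * slopeOfLevel s 0) * Real.cos (Real.pi * slopeOfLevel s 1) +
        Real.cos (Real.pi * slopeOfLevel s 0) * Real.sin (Real.pi * slopeOfLevel s 1)) /
        (Real.sin (Real.pi * slopeOfLevel s 0) * Real.sin (Real.pi * slopeOfLevel s 1)) := by
    have ha' := ha.ne'
    have hb' := hb.ne'
    simp only [tensionTerm'']
    field_simp
    ring
  rw [this]
  have := Real.pi_pos
  positivity

/-- The identities behind the flux form of the level set equation, for the sines and cosines of two
angles. -/
theorem level_flux_identities {sa ca sb cb a b : ℝ} (hsa : sa ≠ 0) (hsb : sb ≠ 0)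
    (hsc : sa * cb + ca * sb ≠ 0) :
    1 / 2 * ((a - b) + (a + b) * (ca * sb / (sa * cb + ca * sb) - sa * cb / (sa * cb + ca * sb))) =
      (ca / sa * a - cb / sb * b) / (ca / sa + cb / sb) ∧
    1 / 2 * (-(a * b) + (a + b) * (a * (ca * sb / (sa * cb + ca * sb) +
        sa * sb * (sa * sb - ca * cb) / (sa * cb + ca * sb) ^ 2) +
      b * (sa * cb / (sa * cb + ca * sb) +
        sa * sb * (sa * sb - ca * cb) / (sa * cb + ca * sb) ^ 2))) =
      1 / 2 * ((ca / sa * a ^ 2 + cb / sb * b ^ 2 +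
        (sa * sb - ca * cb) / (sa * cb + ca * sb) * (a + b) ^ 2) / (ca / sa + cb / sb)) := by
  have h : ca / sa + cb / sb = (sa * cb + ca * sb) / (sa * sb) := by
    field_simp
    ring
  rw [h]
  constructor
  · field_simp
    ring
  · field_simp
    ring

/-- The choice of mobility makes the first diagonal coefficient the constant 1/2, accounting for the
component s₁/2. As this component ignores s₂, the derivative of G in s₁ carries the whole
off-diagonal sum. -/
theorem isParabolicFlux_levelFlux : IsParabolicFlux levelSlopes
    (fun s i j => levelMobility s * secondPartial i j levelTension s) levelFlux := by
  have hcomp : ∀ s ∈ levelSlopes, ∃ L : Fin 2 → Plane →L[ℝ] ℝ,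
      (∀ i, HasFDerivAt (fun y => levelFlux y i) (L i) s) ∧
      L 0 (EuclideanSpace.single 0 1) = 1 / 2 ∧ L 0 (EuclideanSpace.single 1 1) = 0 ∧
      L 1 (EuclideanSpace.single 0 1) =
        secondPartial 0 1 levelTension s / secondPartial 0 0 levelTension s ∧
      L 1 (EuclideanSpace.single 1 1) =
        1 / 2 * (secondPartial 1 1 levelTension s / secondPartial 0 0 levelTension s) := by
    intro s hs
    obtain ⟨hr0, hr1, hr2⟩ := slopeOfLevel_mem_triangle hs
    have hsc := sin_pi_mul_pos (x := 1 - slopeOfLevel s 0 - slopeOfLevel s 1)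
      (by linarith) (by linarith)
    rw [(sin_cos_third _ _).1] at hsc
    obtain ⟨id0, id1⟩ := level_flux_identities (a := slopeOfLevel s 0) (b := slopeOfLevel s 1)
      (sin_pi_mul_pos hr0 (by linarith)).ne' (sin_pi_mul_pos hr1 (by linarith)).ne' hsc.ne'
    have hs2 : (2 + s 1)⁻¹ / 2 ≠ 0 := by have := hs.2.2; positivity
    have h0 : HasFDerivAt (fun y : Plane => y 0 / 2) ((1 / 2 : ℝ) • coord 0) s :=
      ((hasFDerivAt_coord 0 s).const_mul (1 / 2)).congr_of_eventuallyEq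
        (Eventually.of_forall fun y => by simp only; ring)
    obtain ⟨A, B, hG, hA, hB⟩ : ∃ A B : ℝ, HasFDerivAt levelG (A • coord 0 + B • coord 1) s ∧
        A = secondPartial 0 1 levelTension s / secondPartial 0 0 levelTension s ∧
        B = 1 / 2 * (secondPartial 1 1 levelTension s / secondPartial 0 0 levelTension s) := by
      obtain ⟨h00, h01, -, h11⟩ := secondPartial_levelTension hs
      refine ⟨_, _, hasFDerivAt_levelG hs rfl rfl rfl rfl, ?_, ?_⟩
      · rw [h01, h00, mul_div_mul_left _ _ hs2]
        simp only [tensionTerm'', mul_assoc, ← mul_sub, ← mul_add]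
        rw [mul_div_mul_left _ _ Real.pi_ne_zero, ← id0, (sin_cos_third _ _).1]
        ring
      · rw [h11, h00, mul_div_mul_left _ _ hs2]
        simp only [tensionTerm'', mul_assoc, ← mul_add]
        rw [mul_div_mul_left _ _ Real.pi_ne_zero, (sin_cos_third _ _).1, (sin_cos_third _ _).2,
          ← id1]
        ring
    refine ⟨![(1 / 2 : ℝ) • coord 0, A • coord 0 + B • coord 1], fun i => ?_, by simp, by simp,
      by simp [hA], by simp [hB]⟩
    fin_cases i
    · exact h0
    · exact hG
  refine ⟨convex_levelSlopes, fun s hs => ?_, fun s hs => ?_, fun s hs => ?_, fun s hs => ?_,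
    fun s hs x y => ?_⟩
  · obtain ⟨L, hL, -⟩ := hcomp s hs
    exact (fderiv_of_components hL).1
  · obtain ⟨L, hL, h00, -⟩ := hcomp s hs
    have hp := (secondPartial_levelTension_pos hs).ne'
    rw [(fderiv_of_components hL).2, h00, levelMobility]
    field_simp
  · obtain ⟨L, hL, -, -, -, h11⟩ := hcomp s hs
    rw [(fderiv_of_components hL).2, h11, levelMobility]
    ring
  · obtain ⟨L, hL, -, h01, h10, -⟩ := hcomp s hs
    rw [(fderiv_of_components hL).2, (fderiv_of_components hL).2, h01, h10, levelMobility,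
      (secondPartial_levelTension hs).2.2.1, (secondPartial_levelTension hs).2.1]
    ring
  · have hp := secondPartial_levelTension_pos hs
    have hm : 0 < levelMobility s := by rw [levelMobility]; positivity
    obtain ⟨h0, h1, h2⟩ := slopeOfLevel_mem_triangle hs
    -- These arguments are -(2 + s₂) times the differential of ρ(s) in direction (x, y): up to a
    -- positive factor the Hessian of σ̂ is that of σ pulled back by this differential.
    have hform := tensionTerm''_form_nonneg h0 h1 h2 (x + slopeOfLevel s 0 * y)
      (-(x - slopeOfLevel s 1 * y))
    have hs2 : 0 < (2 + s 1)⁻¹ / 2 := by have := hs.2.2; positivity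
    have := mul_nonneg hm.le (mul_nonneg hs2.le hform)
    obtain ⟨h00, h01, h10, h11⟩ := secondPartial_levelTension hs
    simp only [h00, h01, h10, h11]
    linarith

end LozengeHydro

end

/-! ### The three assertions for the two concrete fluxes -/

theorem mainTheorem4 :
    -- the boundary flux inequality for ordered profiles with equal boundary data
    (∀ U : Set LozengeHydro.Plane, LozengeHydro.IsSmoothClosedDomain U →
      ∀ ψ₁ ψ₂ : LozengeHydro.Plane → ℝ,
        ContDiffOn ℝ 1 ψ₁ U → ContDiffOn ℝ 1 ψ₂ U →
        (∀ u ∈ U, gradientWithin ψ₁ U u ∈ LozengeHydro.triangle) →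
        (∀ u ∈ U, gradientWithin ψ₂ U u ∈ LozengeHydro.triangle) →
        (∀ u ∈ U, ψ₂ u ≤ ψ₁ u) → (∀ u ∈ frontier U, ψ₁ u = ψ₂ u) →
        IntegrableOn
          (LozengeHydro.normalComponent U fun u =>
            LozengeHydro.fluxW (gradientWithin ψ₁ U u) - LozengeHydro.fluxW (gradientWithin ψ₂ U u))
          (frontier U) (Measure.hausdorffMeasure 1) ∧
        LozengeHydro.boundaryFlux U (fun u =>
          LozengeHydro.fluxW (gradientWithin ψ₁ U u) - LozengeHydro.fluxW (gradientWithin ψ₂ U u))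
            ≤ 0) ∧
    -- volume drift for the height function
    (∀ U : Set LozengeHydro.Plane, LozengeHydro.IsSmoothClosedDomain U →
      ∀ (f₁ f₂ : LozengeHydro.Plane → ℝ) (ψ₁ ψ₂ : LozengeHydro.Plane → ℝ → ℝ),
        LozengeHydro.IsHeightSolution U f₁ ψ₁ → LozengeHydro.IsHeightSolution U f₂ ψ₂ →
        (∀ u ∈ U, f₂ u ≤ f₁ u) → (∀ u ∈ frontier U, f₁ u = f₂ u) →
        (∀ t : ℝ, 0 ≤ t → ∀ u ∈ U, ψ₂ u t ≤ ψ₁ u t) ∧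
        (∀ t : ℝ, 0 ≤ t →
          IntegrableOn
            (LozengeHydro.normalComponent U fun u =>
              LozengeHydro.fluxW (LozengeHydro.spaceGrad U ψ₁ t u)
                - LozengeHydro.fluxW (LozengeHydro.spaceGrad U ψ₂ t u))
            (frontier U) (Measure.hausdorffMeasure 1) ∧
          HasDerivWithinAt
            (fun s => LozengeHydro.volumeBelow U (fun u => ψ₁ u s)
              - LozengeHydro.volumeBelow U (fun u => ψ₂ u s))
            (LozengeHydro.boundaryFlux U fun u =>
              LozengeHydro.fluxW (LozengeHydro.spaceGrad U ψ₁ t u)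
                - LozengeHydro.fluxW (LozengeHydro.spaceGrad U ψ₂ t u))
            (Ici 0) t ∧
          (LozengeHydro.boundaryFlux U fun u =>
              LozengeHydro.fluxW (LozengeHydro.spaceGrad U ψ₁ t u)
                - LozengeHydro.fluxW (LozengeHydro.spaceGrad U ψ₂ t u)) ≤ 0) ∧
        AntitoneOn (fun t : ℝ => ∫ u in U, |ψ₁ u t - ψ₂ u t|) (Ici 0)) ∧
    -- volume drift for the level set function
    (∀ V : Set LozengeHydro.Plane, LozengeHydro.IsSmoothClosedDomain V →
      ∀ (g₁ g₂ : LozengeHydro.Plane → ℝ) (φ₁ φ₂ : LozengeHydro.Plane → ℝ → ℝ),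
        LozengeHydro.IsLevelSolution V g₁ φ₁ → LozengeHydro.IsLevelSolution V g₂ φ₂ →
        (∀ v ∈ V, g₂ v ≤ g₁ v) → (∀ v ∈ frontier V, g₁ v = g₂ v) →
        (∀ t : ℝ, 0 ≤ t → ∀ v ∈ V, φ₂ v t ≤ φ₁ v t) ∧
        (∀ t : ℝ, 0 ≤ t →
          IntegrableOn
            (LozengeHydro.normalComponent V fun v =>
              LozengeHydro.levelFlux (LozengeHydro.spaceGrad V φ₁ t v)
                - LozengeHydro.levelFlux (LozengeHydro.spaceGrad V φ₂ t v))
            (frontier V) (Measure.hausdorffMeasure 1) ∧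
          HasDerivWithinAt
            (fun s => ∫ v in V, (φ₁ v s - φ₂ v s))
            (LozengeHydro.boundaryFlux V fun v =>
              LozengeHydro.levelFlux (LozengeHydro.spaceGrad V φ₁ t v)
                - LozengeHydro.levelFlux (LozengeHydro.spaceGrad V φ₂ t v))
            (Ici 0) t ∧
          (LozengeHydro.boundaryFlux V fun v =>
              LozengeHydro.levelFlux (LozengeHydro.spaceGrad V φ₁ t v)
                - LozengeHydro.levelFlux (LozengeHydro.spaceGrad V φ₂ t v)) ≤ 0) ∧
        AntitoneOn (fun t : ℝ => ∫ v in V, |φ₁ v t - φ₂ v t|) (Ici 0)) := by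
  refine ⟨fun U hU ψ₁ ψ₂ h₁ h₂ hS₁ hS₂ hle heq =>
      LozengeHydro.isParabolicFlux_fluxW.boundaryFlux_nonpos hU h₁ h₂ hS₁ hS₂ hle heq,
    fun U hU f₁ f₂ ψ₁ ψ₂ h₁ h₂ hle heq => ?_,
    fun V hV g₁ g₂ φ₁ φ₂ h₁ h₂ hle heq =>
      LozengeHydro.isParabolicFlux_levelFlux.volume_drift hV h₁ h₂ hle heq⟩
  obtain ⟨hc, hd, ha⟩ := LozengeHydro.isParabolicFlux_fluxW.volume_drift hU h₁ h₂ hle heq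
  -- Splitting the integral needs integrability of each slice, known only for s ≥ 0; this suffices
  -- for a derivative within `Ici 0`.
  have hvol : ∀ s ∈ Ici (0 : ℝ),
      LozengeHydro.volumeBelow U (fun u => ψ₁ u s) - LozengeHydro.volumeBelow U (fun u => ψ₂ u s) =
        ∫ u in U, (ψ₁ u s - ψ₂ u s) := fun s hs =>
    (integral_sub ((h₁.contDiffOn_slice hs).continuousOn.integrableOn_compact hU.isCompact)
      ((h₂.contDiffOn_slice hs).continuousOn.integrableOn_compact hU.isCompact)).symm
  exact ⟨hc, fun t ht => ⟨(hd t ht).1, (hd t ht).2.1.congr hvol (hvol t ht), (hd t ht).2.2⟩, ha⟩
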